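/- Let $0<\delta<1$ and let $\mathbb{A}_\delta^+=\{z\in\mathbb{C} : \delta<|z|<1,\ \operatorname{Im} z>0\}$ be the half-annulus with the flat metric $g_{\mathbb{A}}=|dz|^2/|z|^2$. Let $\Delta_m$ be the nonnegative self-adjoint Laplacian of $g_{\mathbb{A}}$ on $L^2(\mathbb{A}_\delta^+,\mathrm{dv}_{g_{\mathbb{A}}})$ with Dirichlet condition on the two boundary half-circles $\{|z|=1\}$, $\{|z|=\delta\}$ and Neumann condition on the two segments $[-1,-\delta]\cup[\delta,1]$, and let $\Delta_D$ be the one with Dirichlet condition on the whole boundary. For such an operator $\Delta$ with discrete spectrum, let $\zeta_\Delta(s)=\sum_{\lambda\neq0}\lambda^{-s}$ (sum over the nonzero eigenvalues, repeated according to multiplicity) for $\operatorname{Re}(s)$ large; it extends meromorphically to $\mathbb{C}$, analytically near $s=0$, and one sets $\det(\Delta)=\exp(-\zeta_\Delta'(0))$. Then $$\det(\Delta_m)=-\sqrt{\frac{2}{\pi}}\,(\log\delta)\,\delta^{1/12}\prod_{n\ge1}(1-\delta^{2n}),\qquad \det(\Delta_D)=\frac{1}{\sqrt{2\pi}}\,\delta^{1/12}\prod_{n\ge1}(1-\delta^{2n}).$$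 -/

import Mathlib

open MeasureTheory Set Filter Topology
open scoped ContDiff

namespace SpectralDet

/-! ### Zeta-regularised determinants of self-adjoint operators with discrete spectrum -/

section Zeta

universe u

variable {H : Type u} [NormedAddCommGroup H] [InnerProductSpace ℂ H] [CompleteSpace H]

/-- `Z` is the spectral zeta function of the unbounded operator `A`: the operator `A` is
self-adjoint and nonnegative with an orthonormal basis of eigenvectors `b i`, of eigenvalues `l i`,
the trace `Tr (A ^ (-s) (1 - Π_{ker A})) = ∑_{l i ≠ 0} (l i) ^ (-s)` converges (absolutely) and
equals `Z s` for `Re s` large, and `Z` is meromorphic on `ℂ` and analytic at `0`.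
The eigenvalues are repeated according to multiplicity, so the sum does not depend on the basis,
and `Z` is determined near `0` by the identity theorem. -/
def IsSpectralZeta (A : H →ₗ.[ℂ] H) (Z : ℂ → ℂ) : Prop :=
  IsSelfAdjoint A ∧
  (∃ (ι : Type u) (b : HilbertBasis ι ℂ H) (l : ι → ℝ),
    (∀ i, 0 ≤ l i ∧ ((b i : H), (l i : ℂ) • (b i : H)) ∈ A.graph) ∧
    ∃ σ : ℝ, ∀ s : ℂ, σ < s.re →
      HasSum (fun i : {i : ι // l i ≠ 0} => ((l i.1 : ℝ) : ℂ) ^ (-s)) (Z s)) ∧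
  Meromorphic Z ∧ AnalyticAt ℂ Z 0

/-- The zeta-regularised determinant of `A` exists and equals `d`, that is `d = exp (-ζ_A'(0))`. -/
def HasZetaDet (A : H →ₗ.[ℂ] H) (d : ℝ) : Prop :=
  ∃ Z : ℂ → ℂ, IsSpectralZeta A Z ∧ (d : ℂ) = Complex.exp (-deriv Z 0)

end Zeta

/-! ### The Laplacian of a conformal metric on a planar domain, with mixed boundary conditions

The metric is `g = ρ |dz|²` on `Ω ⊆ ℂ`; Dirichlet conditions are imposed on `D ⊆ ∂Ω` and Neumann
conditions on `∂Ω \ D`. -/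

noncomputable section Laplacian

/-- The Riemannian area measure `dv_g = ρ dx dy` on `Ω`. -/
def areaMeasure (Ω : Set ℂ) (ρ : ℂ → ℝ) : Measure ℂ :=
  (volume.restrict Ω).withDensity fun z => ENNReal.ofReal (ρ z)

/-- `L²(Ω, dv_g)`, with complex values. -/
abbrev L2 (Ω : Set ℂ) (ρ : ℂ → ℝ) : Type := Lp ℂ 2 (areaMeasure Ω ρ)

/-- For `v = 1` and `v = I`, the derivatives of `φ` along the vectors `ρ^{-1/2} ∂_x`,
`ρ^{-1/2} ∂_y` of a `g`-orthonormal frame. -/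
def frameDeriv (ρ : ℂ → ℝ) (v : ℂ) (φ : ℂ → ℂ) (z : ℂ) : ℂ :=
  (((√(ρ z))⁻¹ : ℝ) : ℂ) * fderiv ℝ φ z v

/-- The pairs `(u, ∇u)`, with `∇u` given by its two components in the orthonormal frame, where `u`
is the restriction to `Ω` of a smooth function on `ℂ` that vanishes in a neighbourhood of `D`,
with `u` and `∇u` square integrable. -/
def smoothGradGraph (Ω : Set ℂ) (ρ : ℂ → ℝ) (D : Set ℂ) :
    Submodule ℂ (L2 Ω ρ × L2 Ω ρ × L2 Ω ρ) where
  carrier := {p | ∃ φ : ℂ → ℂ, ContDiff ℝ ∞ φ ∧ Disjoint (tsupport φ) D ∧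
    p.1 =ᵐ[areaMeasure Ω ρ] φ ∧
    p.2.1 =ᵐ[areaMeasure Ω ρ] frameDeriv ρ 1 φ ∧
    p.2.2 =ᵐ[areaMeasure Ω ρ] frameDeriv ρ Complex.I φ}
  zero_mem' := by
    refine ⟨0, contDiff_const, by simp [tsupport], Lp.coeFn_zero _ _ _, ?_, ?_⟩
    · filter_upwards [Lp.coeFn_zero ℂ 2 (areaMeasure Ω ρ)] with z hz
      exact hz.trans (by simp [frameDeriv])
    · filter_upwards [Lp.coeFn_zero ℂ 2 (areaMeasure Ω ρ)] with z hz
      exact hz.trans (by simp [frameDeriv])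
  add_mem' := by
    rintro p q ⟨φ, hφ, hφD, h1, h2, h3⟩ ⟨ψ, hψ, hψD, k1, k2, k3⟩
    have key : ∀ v z, frameDeriv ρ v (φ + ψ) z = frameDeriv ρ v φ z + frameDeriv ρ v ψ z := by
      intro v z
      have := fderiv_add (𝕜 := ℝ) (hφ.differentiable (by simp) z) (hψ.differentiable (by simp) z)
      simp [frameDeriv, this, mul_add]
    refine ⟨φ + ψ, hφ.add hψ, ?_, ?_, ?_, ?_⟩
    · exact Disjoint.mono_left (tsupport_add φ ψ) (disjoint_union_left.2 ⟨hφD, hψD⟩)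
    · filter_upwards [Lp.coeFn_add p.1 q.1, h1, k1] with z hz a b
      exact hz.trans (by rw [Pi.add_apply, Pi.add_apply, a, b])
    · filter_upwards [Lp.coeFn_add p.2.1 q.2.1, h2, k2] with z hz a b
      exact hz.trans (by rw [Pi.add_apply, key, a, b])
    · filter_upwards [Lp.coeFn_add p.2.2 q.2.2, h3, k3] with z hz a b
      exact hz.trans (by rw [Pi.add_apply, key, a, b])
  smul_mem' := by
    rintro c p ⟨φ, hφ, hφD, h1, h2, h3⟩
    have key : ∀ v z, frameDeriv ρ v (c • φ) z = c * frameDeriv ρ v φ z := by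
      intro v z
      have := fderiv_const_smul (𝕜 := ℝ) (hφ.differentiable (by simp) z) c
      simp [frameDeriv, this, mul_left_comm]
    refine ⟨c • φ, contDiff_const.smul hφ, ?_, ?_, ?_, ?_⟩
    · exact hφD.mono_left (closure_mono (Function.support_const_smul_subset c φ))
    · filter_upwards [Lp.coeFn_smul c p.1, h1] with z hz a
      simp [hz, a]
    · filter_upwards [Lp.coeFn_smul c p.2.1, h2] with z hz a
      simp [hz, a, key]
    · filter_upwards [Lp.coeFn_smul c p.2.2, h3] with z hz a
      simp [hz, a, key]

/-- The pairs `(u, ∇u)` with `u` in the form domain: the closure, in the `H¹` norm, of the smooth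
functions that vanish near `D`. For `D = ∂Ω` this is `H¹₀(Ω)`. -/
def gradGraph (Ω : Set ℂ) (ρ : ℂ → ℝ) (D : Set ℂ) : Submodule ℂ (L2 Ω ρ × L2 Ω ρ × L2 Ω ρ) :=
  (smoothGradGraph Ω ρ D).topologicalClosure

/-- The graph of the nonnegative Laplacian `Δ_g`: the pairs `(u, f)` with `u` in the form domain
and `∫ g(∇u, ∇v) dv_g = ∫ f v dv_g` (with `v` conjugated) for all `v` in the form domain. -/
def laplacianGraph (Ω : Set ℂ) (ρ : ℂ → ℝ) (D : Set ℂ) : Submodule ℂ (L2 Ω ρ × L2 Ω ρ) where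
  carrier := {q | ∃ w : L2 Ω ρ × L2 Ω ρ, (q.1, w) ∈ gradGraph Ω ρ D ∧
    ∀ p ∈ gradGraph Ω ρ D, inner ℂ p.2.1 w.1 + inner ℂ p.2.2 w.2 = inner ℂ p.1 q.2}
  zero_mem' := ⟨0, zero_mem _, by simp⟩
  add_mem' := by
    rintro q r ⟨w, hw, h⟩ ⟨x, hx, k⟩
    refine ⟨w + x, add_mem hw hx, fun p hp => ?_⟩
    simp only [Prod.fst_add, Prod.snd_add, inner_add_right, ← h p hp, ← k p hp]
    ring
  smul_mem' := by
    rintro c q ⟨w, hw, h⟩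
    refine ⟨c • w, Submodule.smul_mem _ c hw, fun p hp => ?_⟩
    simp only [Prod.smul_fst, Prod.smul_snd, inner_smul_right, ← h p hp]
    ring

/-- The Laplacian of `g = ρ |dz|²` on `Ω` as an unbounded operator on `L²(Ω, dv_g)`, with Dirichlet
condition on `D` and Neumann condition on the rest of the boundary: the self-adjoint operator
associated with the closed Dirichlet form. Its graph is `laplacianGraph`, see `laplacian_graph`. -/
def laplacian (Ω : Set ℂ) (ρ : ℂ → ℝ) (D : Set ℂ) : L2 Ω ρ →ₗ.[ℂ] L2 Ω ρ :=
  (laplacianGraph Ω ρ D).toLinearPMap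

/-- The half-annulus `{z : δ < |z| < 1, Im z > 0}`. -/
def halfAnnulus (δ : ℝ) : Set ℂ := {z | δ < ‖z‖ ∧ ‖z‖ < 1 ∧ 0 < z.im}

/-- The two closed boundary half-circles of the half-annulus. -/
def halfCircles (δ : ℝ) : Set ℂ := {z | (‖z‖ = δ ∨ ‖z‖ = 1) ∧ 0 ≤ z.im}

/-- The conformal factor of the metric `|dz|² / |z|²`. -/
def flatFactor (z : ℂ) : ℝ := 1 / ‖z‖ ^ 2

/-- The Laplacian of `|dz|² / |z|²` on the half-annulus, with Dirichlet condition on the two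
half-circles and Neumann condition on the two segments `[-1, -δ]` and `[δ, 1]`. -/
def mixedLaplacian (δ : ℝ) : L2 (halfAnnulus δ) flatFactor →ₗ.[ℂ] L2 (halfAnnulus δ) flatFactor :=
  laplacian (halfAnnulus δ) flatFactor (halfCircles δ)

/-- The Laplacian of `|dz|² / |z|²` on the half-annulus, with Dirichlet condition on the whole
boundary. -/
def dirichletLaplacian (δ : ℝ) :
    L2 (halfAnnulus δ) flatFactor →ₗ.[ℂ] L2 (halfAnnulus δ) flatFactor :=
  laplacian (halfAnnulus δ) flatFactor (frontier (halfAnnulus δ))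

/-! ### The Laplacian is well defined -/

variable {Ω : Set ℂ} {ρ : ℂ → ℝ} {D : Set ℂ}

theorem areaMeasure_lt_top (hρ : ContinuousOn ρ Ω) {K : Set ℂ} (hK : IsCompact K) (hKΩ : K ⊆ Ω) :
    areaMeasure Ω ρ K < ⊤ := by
  obtain ⟨C, hC⟩ := hK.exists_bound_of_continuousOn (hρ.mono hKΩ)
  rw [areaMeasure, withDensity_apply _ hK.measurableSet]
  calc ∫⁻ z in K, ENNReal.ofReal (ρ z) ∂(volume.restrict Ω)
      ≤ ∫⁻ _ in K, ENNReal.ofReal C ∂(volume.restrict Ω) := by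
        refine setLIntegral_mono measurable_const fun z hz => ?_
        exact ENNReal.ofReal_le_ofReal ((le_abs_self _).trans (hC z hz))
    _ = ENNReal.ofReal C * (volume.restrict Ω) K := by simp
    _ < ⊤ := ENNReal.mul_lt_top ENNReal.ofReal_lt_top
        ((Measure.restrict_apply_le _ _).trans_lt hK.measure_lt_top)

theorem memLp_of_compact (hρ : ContinuousOn ρ Ω) {K : Set ℂ} (hK : IsCompact K) (hKΩ : K ⊆ Ω)
    {h : ℂ → ℂ} (hc : ContinuousOn h K) (h0 : ∀ z ∉ K, h z = 0) :
    MemLp h 2 (areaMeasure Ω ρ) := by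
  have hfin := areaMeasure_lt_top hρ hK hKΩ
  obtain ⟨C, hC⟩ := hK.exists_bound_of_continuousOn hc
  have e : K.indicator h = h := indicator_eq_self.2 fun z hz => by
    by_contra hzK
    exact hz (h0 z hzK)
  rw [← e, memLp_indicator_iff_restrict hK.measurableSet]
  have : IsFiniteMeasure ((areaMeasure Ω ρ).restrict K) := ⟨by simpa using hfin⟩
  refine MemLp.of_bound (hc.aestronglyMeasurable hK.measurableSet) C ?_
  exact (ae_restrict_iff' hK.measurableSet).2 (Eventually.of_forall hC)

theorem laplacian_graph (hΩ : IsOpen Ω) (hρ : ContinuousOn ρ Ω) (hpos : ∀ z ∈ Ω, 0 < ρ z)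
    (hD : Disjoint Ω D) : (laplacian Ω ρ D).graph = laplacianGraph Ω ρ D := by
  refine Submodule.toLinearPMap_graph_eq _ ?_
  rintro ⟨u, f⟩ ⟨w, hw, h⟩ hu
  change u = 0 at hu
  subst hu
  have hw0 : w.1 = 0 ∧ w.2 = 0 := by
    have h1 := h _ hw
    simp only [inner_zero_left, inner_self_eq_norm_sq_to_K] at h1
    have h2 : ‖w.1‖ ^ 2 + ‖w.2‖ ^ 2 = 0 := by
      have h3 := congrArg Complex.re h1
      simpa [← Complex.ofReal_pow] using h3
    constructor
    · have : ‖w.1‖ = 0 := by nlinarith [sq_nonneg ‖w.1‖, sq_nonneg ‖w.2‖]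
      simpa using this
    · have : ‖w.2‖ = 0 := by nlinarith [sq_nonneg ‖w.1‖, sq_nonneg ‖w.2‖]
      simpa using this
  have hf : ∀ p ∈ gradGraph Ω ρ D, inner ℂ p.1 f = 0 := by
    intro p hp
    have := h p hp
    simpa [hw0.1, hw0.2] using this.symm
  have hloc : LocallyIntegrableOn f Ω (areaMeasure Ω ρ) := by
    intro x hx
    obtain ⟨K, hK, hxK, hKΩ⟩ := exists_compact_subset hΩ hx
    refine ⟨K, mem_nhdsWithin_of_mem_nhds (mem_interior_iff_mem_nhds.1 hxK), ?_⟩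
    have : IsFiniteMeasure ((areaMeasure Ω ρ).restrict K) :=
      ⟨by simpa using areaMeasure_lt_top hρ hK hKΩ⟩
    exact ((Lp.memLp f).restrict K).integrable (by norm_num)
  have hz := hΩ.ae_eq_zero_of_integral_contDiff_smul_eq_zero hloc (by
    intro g hg hgc hgΩ
    have hφ : ContDiff ℝ ∞ (fun z => (g z : ℂ)) := Complex.ofRealCLM.contDiff.comp hg
    have hsup : tsupport (fun z => (g z : ℂ)) = tsupport g := by
      simp only [tsupport]
      congr 1
      ext z
      simp
    have hout : ∀ z ∉ tsupport g, (g z : ℂ) = 0 := fun z hz => by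
      simp [image_eq_zero_of_notMem_tsupport hz]
    have m0 : MemLp (fun z => (g z : ℂ)) 2 (areaMeasure Ω ρ) :=
      memLp_of_compact hρ hgc hgΩ hφ.continuous.continuousOn hout
    have m1 : ∀ v, MemLp (frameDeriv ρ v fun z => (g z : ℂ)) 2 (areaMeasure Ω ρ) := fun v => by
      refine memLp_of_compact hρ hgc hgΩ ?_ ?_
      · refine ContinuousOn.mul (Complex.continuous_ofReal.comp_continuousOn
          (ContinuousOn.inv₀ ((hρ.mono hgΩ).sqrt) fun z hz =>
            (Real.sqrt_pos.2 (hpos z (hgΩ hz))).ne')) ?_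
        exact ((hφ.continuous_fderiv (by simp)).clm_apply continuous_const).continuousOn
      · intro z hz
        have : fderiv ℝ (fun z => (g z : ℂ)) z = 0 := by
          refine image_eq_zero_of_notMem_tsupport fun h' => hz ?_
          exact hsup ▸ tsupport_fderiv_subset ℝ h'
        simp [frameDeriv, this]
    have hmem : (m0.toLp _, (m1 1).toLp _, (m1 Complex.I).toLp _) ∈ gradGraph Ω ρ D := by
      refine Submodule.le_topologicalClosure _ ⟨_, hφ, ?_, m0.coeFn_toLp, (m1 1).coeFn_toLp,
        (m1 Complex.I).coeFn_toLp⟩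
      rw [hsup]
      exact hD.mono_left hgΩ
    have := hf _ hmem
    rw [L2.inner_def] at this
    rw [← this]
    refine integral_congr_ae ?_
    filter_upwards [m0.coeFn_toLp] with z hz
    simp [hz, mul_comm])
  have hΩae : ∀ᵐ z ∂(areaMeasure Ω ρ), z ∈ Ω :=
    (withDensity_absolutelyContinuous _ _).ae_le (ae_restrict_mem hΩ.measurableSet)
  refine (Lp.eq_zero_iff_ae_eq_zero).2 ?_
  filter_upwards [hz, hΩae] with z a b
  exact a b

theorem isOpen_halfAnnulus (δ : ℝ) : IsOpen (halfAnnulus δ) :=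
  (isOpen_lt continuous_const continuous_norm).inter
    ((isOpen_lt continuous_norm continuous_const).inter
      (isOpen_lt continuous_const Complex.continuous_im))

theorem flatFactor_pos {δ : ℝ} {z : ℂ} (hz : z ∈ halfAnnulus δ) : 0 < flatFactor z := by
  have : z ≠ 0 := fun h => by simpa [h] using hz.2.2
  unfold flatFactor
  positivity

theorem continuousOn_flatFactor (δ : ℝ) : ContinuousOn flatFactor (halfAnnulus δ) := by
  refine ContinuousOn.div continuousOn_const (continuous_norm.pow 2).continuousOn fun z hz h => ?_
  have := flatFactor_pos hz
  simp [flatFactor, h] at this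

theorem mixedLaplacian_graph (δ : ℝ) : (mixedLaplacian δ).graph =
    laplacianGraph (halfAnnulus δ) flatFactor (halfCircles δ) := by
  refine laplacian_graph (isOpen_halfAnnulus δ) (continuousOn_flatFactor δ)
    (fun z hz => flatFactor_pos hz) (disjoint_left.2 ?_)
  rintro z ⟨h1, h2, -⟩ ⟨h | h, -⟩
  · exact h1.ne' h
  · exact h2.ne h

theorem dirichletLaplacian_graph (δ : ℝ) : (dirichletLaplacian δ).graph =
    laplacianGraph (halfAnnulus δ) flatFactor (frontier (halfAnnulus δ)) :=
  laplacian_graph (isOpen_halfAnnulus δ) (continuousOn_flatFactor δ)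
    (fun _ hz => flatFactor_pos hz) (disjoint_iff_inter_eq_empty.2 (isOpen_halfAnnulus δ).inter_frontier_eq)

end Laplacian

end SpectralDet

/-! In logarithmic coordinates `z = exp (x + iθ)` the metric `|dz|²/|z|²` becomes `dx² + dθ²`, so
the half-annulus is isometric to a flat rectangle of sides `L = -log δ` and `π`. Separation of
variables gives the eigenvalues `n² + (π m / L)²` with `m ≥ 1`, and with `n ≥ 1` in the Dirichlet
case, `n ≥ 0` in the mixed case.

Zeta side. Write `θ(t) = ∑_{n ≥ 1} exp (-n² t)`. In the Dirichlet case `Γ(s) ζ(s)` is the Mellin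
transform of `θ(t) θ((π/L)² t)`. Poisson summation is applied to the second factor only
(`halfTheta_mul_eq`). It leaves two terms whose transforms are `Γ(s) ζ_R(2s)` and `Γ(s - 1/2) ζ_R(2s
- 1)` up to constants, with `ζ_R` Riemann's zeta function, and the kernel `t ^ (-1/2) θ(t) θ(L²/t)`,
which decays rapidly at both ends and so has an entire transform. This is the meromorphic
continuation. As `1/Γ(s) = s + O(s²)`, the derivative at `0` is `½ log 2π + L/12` plus `L/√π` times
the transform of the kernel at `0`. That value is a double sum of Bessel integrals of half-integer
order, which are elementary (`besselIntegral`); it sums to `-(√π/L) ∑ log (1 - δ^{2n})`, whence the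
infinite product. The modes `n = 0` of the mixed problem add `(π/L)^{-2s} ζ_R(2s)`, which multiplies
the determinant by `2L = -2 log δ`.

Operator side. The Laplacian is defined weakly, so the separated functions must be shown to be a
complete system of eigenvectors of it. They lie in the form domain by a truncation argument
(`smoothPair_mem_gradGraph`), satisfy the weak equation by Green's formula (`green_separated`), and
are complete by Stone–Weierstrass for cosines (`ae_eq_zero_of_cos_moments`). The graph is symmetric
and closed, and with an eigenbasis this forces self-adjointness (`isSelfAdjoint_of_hilbertBasis`).
-/

namespace SpectralDet

/-! ### The theta function of the half line and its Mellin transform -/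

noncomputable section HalfTheta

/-- The sum `∑_{n ≥ 1} exp (-n² t)`. -/
def halfTheta (t : ℝ) : ℝ := ∑' n : ℕ, Real.exp (-((n + 1 : ℝ) ^ 2 * t))

theorem exp_neg_sq_mul_le (N n : ℕ) {t : ℝ} (ht : 0 < t) :
    Real.exp (-((n + 1 : ℝ) ^ 2 * t)) ≤ N.factorial * (1 / (n + 1 : ℝ) ^ (2 * N)) * (t ^ N)⁻¹ := by
  have h := Real.pow_div_factorial_le_exp ((n + 1 : ℝ) ^ 2 * t) (by positivity) N
  rw [Real.exp_neg]
  refine (inv_anti₀ (by positivity) h).trans_eq ?_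
  rw [mul_pow, ← pow_mul]
  field_simp

theorem summable_one_div_succ_pow {N : ℕ} (hN : N ≠ 0) :
    Summable fun n : ℕ => 1 / (n + 1 : ℝ) ^ (2 * N) := by
  have := (summable_nat_add_iff 1).2 (Real.summable_one_div_nat_pow.2 (by omega : 1 < 2 * N))
  simpa using this

theorem summable_halfTheta {t : ℝ} (ht : 0 < t) :
    Summable fun n : ℕ => Real.exp (-((n + 1 : ℝ) ^ 2 * t)) :=
  Summable.of_nonneg_of_le (fun _ => (Real.exp_pos _).le) (fun n => exp_neg_sq_mul_le 1 n ht)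
    (((summable_one_div_succ_pow one_ne_zero).mul_left _).mul_right _)

theorem halfTheta_nonneg (t : ℝ) : 0 ≤ halfTheta t := tsum_nonneg fun _ => (Real.exp_pos _).le

/-- Large `N` gives rapid decay at infinity, and `N = 1` a crude bound `O(1/t)` near `0`. The true
order there is `t ^ (-1/2)`, but only large `Re s` matters for the Mellin transform of `halfTheta`,
and the theta kernel can absorb any power. -/
theorem exists_halfTheta_le {N : ℕ} (hN : N ≠ 0) :
    ∃ C : ℝ, 0 < C ∧ ∀ t : ℝ, 0 < t → halfTheta t ≤ C * (t ^ N)⁻¹ := by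
  have hs := summable_one_div_succ_pow hN
  refine ⟨∑' n : ℕ, N.factorial * (1 / (n + 1 : ℝ) ^ (2 * N)),
    (hs.mul_left _).tsum_pos (fun n => by positivity) 0 (by positivity), fun t ht => ?_⟩
  rw [← tsum_mul_right]
  exact (summable_halfTheta ht).tsum_le_tsum (fun n => exp_neg_sq_mul_le N n ht)
    ((hs.mul_left _).mul_right _)

theorem continuousOn_halfTheta : ContinuousOn halfTheta (Ioi 0) := by
  intro t ht
  have ht' : 0 < t := ht
  have : ContinuousOn halfTheta (Ioi (t / 2)) := by
    refine continuousOn_tsum (fun n => by fun_prop) (summable_halfTheta (half_pos ht'))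
      fun n x hx => ?_
    rw [Real.norm_of_nonneg (Real.exp_pos _).le]
    gcongr
    exact (mem_Ioi.1 hx).le
  exact (this.continuousAt (Ioi_mem_nhds (by linarith))).continuousWithinAt

/-- Jacobi's inversion formula (Poisson summation), with the sum over `ℤ` folded onto the positive
integers. -/
theorem one_add_two_mul_halfTheta {t : ℝ} (ht : 0 < t) :
    1 + 2 * halfTheta t = √(Real.pi / t) * (1 + 2 * halfTheta (Real.pi ^ 2 / t)) := by
  have key : ∀ a : ℝ, 0 < a →
      ∑' n : ℤ, Real.exp (-Real.pi * a * (n : ℝ) ^ 2) = 1 + 2 * halfTheta (Real.pi * a) := by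
    intro a ha
    have hs := summable_halfTheta (mul_pos Real.pi_pos ha)
    have e : ∀ n : ℕ, Real.exp (-Real.pi * a * (((n : ℤ) + 1 : ℤ) : ℝ) ^ 2)
        = Real.exp (-((n + 1 : ℝ) ^ 2 * (Real.pi * a))) := fun n => by
      push_cast; ring_nf
    have e' : ∀ n : ℕ, Real.exp (-Real.pi * a * ((-((n : ℤ) + 1) : ℤ) : ℝ) ^ 2)
        = Real.exp (-((n + 1 : ℝ) ^ 2 * (Real.pi * a))) := fun n => by
      push_cast; ring_nf
    have h := HasSum.of_add_one_of_neg_add_one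
      (f := fun n : ℤ => Real.exp (-Real.pi * a * (n : ℝ) ^ 2))
      (by simpa only [e] using hs.hasSum) (by simpa only [e'] using hs.hasSum)
    rw [h.tsum_eq, halfTheta]
    simp
    ring
  have h := Real.tsum_exp_neg_mul_int_sq (a := t / Real.pi) (by positivity)
  have h2 := key (Real.pi / t) (by positivity)
  rw [key _ (by positivity)] at h
  have e3 : ∀ n : ℤ, Real.exp (-Real.pi / (t / Real.pi) * (n : ℝ) ^ 2) =
      Real.exp (-Real.pi * (Real.pi / t) * (n : ℝ) ^ 2) := fun n => by
    congr 2; field_simp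
  rw [tsum_congr e3, h2, mul_div_cancel₀ _ Real.pi_ne_zero] at h
  rw [h, ← Real.sqrt_eq_rpow, one_div, ← Real.sqrt_inv, inv_div]
  congr 4
  ring

theorem hasSum_halfTheta_mul (a b : ℝ) (ha : 0 < a) (hb : 0 < b) :
    HasSum (fun p : ℕ × ℕ =>
      Real.exp (-((p.1 + 1 : ℝ) ^ 2 * a)) * Real.exp (-((p.2 + 1 : ℝ) ^ 2 * b)))
      (halfTheta a * halfTheta b) :=
  (summable_halfTheta ha).hasSum.mul (summable_halfTheta hb).hasSum
    ((summable_halfTheta ha).mul_of_nonneg (summable_halfTheta hb)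
      (fun _ => (Real.exp_pos _).le) fun _ => (Real.exp_pos _).le)

theorem mellinConvergent_halfTheta {s : ℂ} (hs : 1 < s.re) :
    MellinConvergent (fun t => (halfTheta t : ℂ)) s := by
  obtain ⟨N, hN⟩ := exists_nat_gt s.re
  have hN0 : N ≠ 0 := by rintro rfl; norm_num at hN; linarith
  obtain ⟨C, -, hC⟩ := exists_halfTheta_le hN0
  obtain ⟨C', -, hC'⟩ := exists_halfTheta_le one_ne_zero
  refine mellinConvergent_of_isBigO_rpow (a := N) (b := 1) ?_ ?_ hN ?_ hs
  · exact (Complex.continuous_ofReal.comp_continuousOn continuousOn_halfTheta).locallyIntegrableOn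
      measurableSet_Ioi
  · refine Asymptotics.IsBigO.of_bound C ?_
    filter_upwards [eventually_gt_atTop 0] with t ht
    rw [Complex.norm_real, Real.norm_of_nonneg (halfTheta_nonneg t), Real.rpow_neg ht.le,
      Real.rpow_natCast, Real.norm_of_nonneg (by positivity)]
    exact hC t ht
  · refine Asymptotics.IsBigO.of_bound C' ?_
    filter_upwards [self_mem_nhdsWithin] with t ht
    rw [Complex.norm_real, Real.norm_of_nonneg (halfTheta_nonneg t), Real.rpow_neg (le_of_lt ht),
      Real.rpow_one, Real.norm_of_nonneg (inv_nonneg.2 (le_of_lt ht))]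
    simpa using hC' t ht

theorem ofReal_sq_cpow {x : ℝ} (hx : 0 ≤ x) (s : ℂ) : ((x ^ 2 : ℝ) : ℂ) ^ s = (x : ℂ) ^ (2 * s) := by
  rw [sq, Complex.ofReal_mul, Complex.mul_cpow_ofReal_nonneg hx hx, Complex.cpow_ofNat_mul, sq]

theorem mellin_halfTheta {s : ℂ} (hs : 1 < s.re) :
    mellin (fun t => (halfTheta t : ℂ)) s = Complex.Gamma s * riemannZeta (2 * s) := by
  have hz : 1 < (2 * s).re := by simp; linarith
  have hcast : ∀ n : ℕ, (((n + 1 : ℝ) ^ 2 : ℝ) : ℂ) ^ s = ((n : ℂ) + 1) ^ (2 * s) := fun n => by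
    rw [ofReal_sq_cpow (by positivity)]
    norm_cast
  have h := hasSum_mellin (a := fun _ : ℕ => (1 : ℂ)) (p := fun n : ℕ => (n + 1 : ℝ) ^ 2)
    (F := fun t => (halfTheta t : ℂ)) (s := s) (fun n => Or.inr (by positivity)) (by linarith)
    (fun t ht => by
      have := Complex.hasSum_ofReal.2 (summable_halfTheta (mem_Ioi.1 ht)).hasSum
      simpa [neg_mul, halfTheta] using this)
    (by
      refine Summable.of_nonneg_of_le (fun n => by positivity) (fun n => ?_)
        (summable_one_div_succ_pow one_ne_zero)
      rw [norm_one, mul_one]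
      gcongr
      exact Real.self_le_rpow_of_one_le (by nlinarith [Nat.cast_nonneg (α := ℝ) n]) hs.le)
  rw [← h.tsum_eq, zeta_eq_tsum_one_div_nat_add_one_cpow hz, ← tsum_mul_left]
  refine tsum_congr fun n => ?_
  rw [hcast]
  ring

end HalfTheta

end SpectralDet

/-! ### Meromorphic continuation of the zeta function of a rectangle, and its derivative at zero -/

namespace SpectralDet

noncomputable section RectangleZeta

/-- The kernel `t ^ (-1/2) θ(t) θ(L² / t)`, with `θ` the theta function of the half line. -/
def thetaKernel (L t : ℝ) : ℂ :=
  (t : ℂ) ^ (-(1 / 2) : ℂ) • ((halfTheta t * halfTheta (L ^ 2 / t) : ℝ) : ℂ)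

theorem norm_thetaKernel (L : ℝ) {t : ℝ} (ht : 0 < t) :
    ‖thetaKernel L t‖ = t ^ (-(1 / 2) : ℝ) * (halfTheta t * halfTheta (L ^ 2 / t)) := by
  rw [thetaKernel, norm_smul, Complex.norm_cpow_eq_rpow_re_of_pos ht, Complex.norm_real,
    Real.norm_of_nonneg (mul_nonneg (halfTheta_nonneg _) (halfTheta_nonneg _))]
  norm_num

theorem continuousOn_thetaKernel {L : ℝ} (hL : 0 < L) : ContinuousOn (thetaKernel L) (Ioi 0) := by
  refine ContinuousOn.smul (f := fun t : ℝ => (t : ℂ) ^ (-(1 / 2) : ℂ)) (fun t ht => ?_) ?_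
  · exact (Complex.continuousAt_ofReal_cpow_const t _ (Or.inr (ne_of_gt ht))).continuousWithinAt
  · have h : ContinuousOn (fun t : ℝ => L ^ 2 / t) (Ioi 0) :=
      continuousOn_const.div continuousOn_id fun t (ht : 0 < t) => ht.ne'
    refine Complex.continuous_ofReal.comp_continuousOn (continuousOn_halfTheta.mul
      (continuousOn_halfTheta.comp h fun t (ht : 0 < t) => ?_))
    exact div_pos (pow_pos hL 2) ht

/-- The factor `θ(t)` contributes `t ^ (-N)` and `θ(L²/t)` contributes `t ^ M`. Large `N` controls
the kernel at infinity, large `M` at `0`; hence its Mellin transform converges for every `s`. -/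
theorem exists_norm_thetaKernel_le {L : ℝ} (hL : 0 < L) {M N : ℕ} (hM : M ≠ 0) (hN : N ≠ 0) :
    ∃ C : ℝ, ∀ t : ℝ, 0 < t → ‖thetaKernel L t‖ ≤ C * ‖t ^ ((M : ℝ) - N - 1 / 2)‖ := by
  obtain ⟨C, hC0, hC⟩ := exists_halfTheta_le hN
  obtain ⟨C', hC0', hC'⟩ := exists_halfTheta_le hM
  refine ⟨C * (C' * ((L ^ 2) ^ M)⁻¹), fun t ht => ?_⟩
  have h1 := hC t ht
  have h2 := hC' (L ^ 2 / t) (by positivity)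
  rw [norm_thetaKernel L ht, Real.norm_of_nonneg (by positivity), sub_eq_add_neg,
    Real.rpow_add ht, Real.rpow_sub ht, Real.rpow_natCast, Real.rpow_natCast]
  calc t ^ (-(1 / 2) : ℝ) * (halfTheta t * halfTheta (L ^ 2 / t))
      ≤ t ^ (-(1 / 2) : ℝ) * ((C * (t ^ N)⁻¹) * (C' * ((L ^ 2 / t) ^ M)⁻¹)) := by
        gcongr
        exact halfTheta_nonneg _
    _ = _ := by
        rw [div_pow]
        field_simp

theorem thetaKernel_mellin_hyps {L : ℝ} (hL : 0 < L) (s : ℂ) :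
    ∃ a b : ℝ, LocallyIntegrableOn (thetaKernel L) (Ioi 0) ∧
      thetaKernel L =O[atTop] (fun t : ℝ => t ^ (-a)) ∧ s.re < a ∧
      thetaKernel L =O[𝓝[>] 0] (fun t : ℝ => t ^ (-b)) ∧ b < s.re := by
  obtain ⟨N, hN⟩ := exists_nat_gt |s.re|
  have h := abs_lt.1 hN
  obtain ⟨C, hC⟩ := exists_norm_thetaKernel_le hL (M := 1) (N := N + 1) one_ne_zero (by omega)
  obtain ⟨C', hC'⟩ := exists_norm_thetaKernel_le hL (M := N + 2) (N := 1) (by omega) one_ne_zero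
  refine ⟨N + 1 / 2, -N - 1 / 2, (continuousOn_thetaKernel hL).locallyIntegrableOn
    measurableSet_Ioi, Asymptotics.IsBigO.of_bound C ?_, by linarith,
    Asymptotics.IsBigO.of_bound C' ?_, by linarith⟩
  · filter_upwards [eventually_gt_atTop 0] with t ht
    convert hC t ht using 4
    push_cast; ring
  · filter_upwards [self_mem_nhdsWithin] with t ht
    convert hC' t ht using 4
    push_cast; ring

theorem differentiable_mellin_thetaKernel {L : ℝ} (hL : 0 < L) :
    Differentiable ℂ (mellin (thetaKernel L)) := fun s => by
  obtain ⟨a, b, h1, h2, h3, h4, h5⟩ := thetaKernel_mellin_hyps hL s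
  exact mellin_differentiableAt_of_isBigO_rpow h1 h2 h3 h4 h5

theorem mellinConvergent_thetaKernel {L : ℝ} (hL : 0 < L) (s : ℂ) :
    MellinConvergent (thetaKernel L) s := by
  obtain ⟨a, b, h1, h2, h3, h4, h5⟩ := thetaKernel_mellin_hyps hL s
  exact mellinConvergent_of_isBigO_rpow h1 h2 h3 h4 h5

/-- The analytic continuation of `Γ(s) (Z(s) + ζ(2s) / 2)`, with `Z` the zeta function of the
Dirichlet Laplacian on a rectangle of sides `L` and `π`. -/
def rectangleMellin (L : ℝ) (s : ℂ) : ℂ :=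
  (L / √Real.pi : ℝ) * (1 / 2 * (Complex.Gamma (s - 1 / 2) * riemannZeta (2 * (s - 1 / 2)))
    + mellin (thetaKernel L) s)

/-- The zeta function of the Dirichlet Laplacian on a rectangle of sides `L` and `π`. -/
def rectangleZeta (L : ℝ) (s : ℂ) : ℂ :=
  -(1 / 2) * riemannZeta (2 * s) + (Complex.Gamma s)⁻¹ * rectangleMellin L s

/-- Inverting only the second factor is the key choice: the non-decaying parts are then multiples of
`θ(t)` and `t ^ (-1/2) θ(t)`, whose Mellin transforms are values of Riemann's zeta function, and
everything else is entire. -/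
theorem halfTheta_mul_eq {L t : ℝ} (hL : 0 < L) (ht : 0 < t) :
    ((halfTheta t * halfTheta ((Real.pi / L) ^ 2 * t) : ℝ) : ℂ) =
      -(1 / 2) * (halfTheta t : ℂ) + (L / √Real.pi : ℝ) *
        (1 / 2 * ((t : ℂ) ^ (-(1 / 2) : ℂ) • (halfTheta t : ℂ)) + thetaKernel L t) := by
  have h := one_add_two_mul_halfTheta (t := (Real.pi / L) ^ 2 * t) (by positivity)
  have e1 : Real.pi ^ 2 / ((Real.pi / L) ^ 2 * t) = L ^ 2 / t := by
    have := Real.pi_ne_zero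
    field_simp
  have e2 : √(Real.pi / ((Real.pi / L) ^ 2 * t)) = L / √Real.pi * t ^ (-(1 / 2) : ℝ) := by
    rw [Real.rpow_neg ht.le, ← Real.sqrt_eq_rpow, ← div_eq_mul_inv, div_div, ← Real.sqrt_mul
      Real.pi_pos.le, Real.sqrt_eq_iff_mul_self_eq_of_pos (by positivity), ← sq, div_pow, Real.sq_sqrt (by positivity)]
    have := Real.pi_ne_zero
    field_simp
  rw [e1, e2] at h
  have h' : halfTheta ((Real.pi / L) ^ 2 * t) =
      -(1 / 2) + L / √Real.pi * (1 / 2 * t ^ (-(1 / 2) : ℝ) +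
        t ^ (-(1 / 2) : ℝ) * halfTheta (L ^ 2 / t)) := by linarith
  have e3 : (t : ℂ) ^ (-(1 / 2) : ℂ) = ((t ^ (-(1 / 2) : ℝ) : ℝ) : ℂ) := by
    rw [Complex.ofReal_cpow ht.le]; norm_num
  rw [h', thetaKernel, e3]
  simp only [smul_eq_mul]
  push_cast
  ring

theorem mellin_halfTheta_mul {L : ℝ} (hL : 0 < L) {s : ℂ} (hs : 2 < s.re) :
    mellin (fun t => ((halfTheta t * halfTheta ((Real.pi / L) ^ 2 * t) : ℝ) : ℂ)) s =
      Complex.Gamma s * rectangleZeta L s := by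
  have hG : Complex.Gamma s ≠ 0 := Complex.Gamma_ne_zero_of_re_pos (by linarith)
  have hs' : 1 < (s - 1 / 2).re := by
    simp; linarith
  have c1 := mellinConvergent_halfTheta (s := s) (by linarith)
  have c2 : MellinConvergent (fun t : ℝ => (t : ℂ) ^ (-(1 / 2) : ℂ) • (halfTheta t : ℂ)) s := by
    rw [MellinConvergent.cpow_smul, ← sub_eq_add_neg]
    exact mellinConvergent_halfTheta hs'
  have h1 : HasMellin (fun t => (halfTheta t : ℂ)) s _ := ⟨c1, mellin_halfTheta (by linarith)⟩
  have h2 : HasMellin (fun t : ℝ => (t : ℂ) ^ (-(1 / 2) : ℂ) • (halfTheta t : ℂ)) s _ := ⟨c2, by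
    rw [mellin_cpow_smul, ← sub_eq_add_neg, mellin_halfTheta hs']⟩
  have c3 := mellinConvergent_thetaKernel hL s
  have h4 := hasMellin_add (c1.const_smul (-(1 / 2) : ℂ))
    (((hasMellin_add (c2.const_smul (1 / 2 : ℂ)) c3).1).const_smul ((L / √Real.pi : ℝ) : ℂ))
  have h5 : mellin (fun t => ((halfTheta t * halfTheta ((Real.pi / L) ^ 2 * t) : ℝ) : ℂ)) s =
      mellin (fun t : ℝ => (-(1 / 2) : ℂ) • (halfTheta t : ℂ) + ((L / √Real.pi : ℝ) : ℂ) •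
        ((1 / 2 : ℂ) • ((t : ℂ) ^ (-(1 / 2) : ℂ) • (halfTheta t : ℂ)) + thetaKernel L t)) s := by
    refine setIntegral_congr_fun measurableSet_Ioi fun t ht => ?_
    simp only [halfTheta_mul_eq hL (mem_Ioi.1 ht), smul_eq_mul]
  rw [h5, h4.2, mellin_const_smul, mellin_const_smul,
    (hasMellin_add (c2.const_smul (1 / 2 : ℂ)) c3).2, mellin_const_smul, h1.2, h2.2,
    rectangleZeta, rectangleMellin]
  simp only [smul_eq_mul]
  field_simp

theorem hasSum_rectangleZeta {L : ℝ} (hL : 0 < L) {s : ℂ} (hs : 2 < s.re) :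
    HasSum (fun p : ℕ × ℕ =>
      (((p.1 + 1 : ℝ) ^ 2 + (Real.pi / L * (p.2 + 1)) ^ 2 : ℝ) : ℂ) ^ (-s)) (rectangleZeta L s) := by
  have hG : Complex.Gamma s ≠ 0 := Complex.Gamma_ne_zero_of_re_pos (by linarith)
  set c := Real.pi / L with hc
  have hc0 : 0 < c := by positivity
  have hsum : Summable fun p : ℕ × ℕ =>
      ‖(1 : ℂ)‖ / ((p.1 + 1 : ℝ) ^ 2 + (c * (p.2 + 1)) ^ 2) ^ s.re := by
    have h1 : Summable fun n : ℕ => ((n + 1 : ℝ) ^ s.re)⁻¹ := by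
      have := (summable_nat_add_iff 1).2 (Real.summable_nat_rpow_inv.2 (by linarith : 1 < s.re))
      simpa using this
    -- Since `x² + y² ≥ x y`, the double series is dominated by a product of two convergent series
    -- `∑ n ^ (-Re s)`.
    refine Summable.of_nonneg_of_le (fun n => by positivity) (fun p => ?_)
      ((h1.mul_of_nonneg h1 (fun _ => by positivity) fun _ => by positivity).mul_left (c ^ s.re)⁻¹)
    rw [norm_one, one_div, ← mul_inv, ← mul_inv, ← Real.mul_rpow (by positivity) (by positivity),
      ← Real.mul_rpow (by positivity) (by positivity)]
    gcongr
    nlinarith [sq_nonneg ((p.1 + 1 : ℝ) - c * (p.2 + 1)), 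
      (by positivity : 0 ≤ c * ((p.1 + 1 : ℝ) * (p.2 + 1)))]
  have h := hasSum_mellin (a := fun _ : ℕ × ℕ => (1 : ℂ))
    (p := fun p : ℕ × ℕ => (p.1 + 1 : ℝ) ^ 2 + (c * (p.2 + 1)) ^ 2)
    (F := fun t => ((halfTheta t * halfTheta (c ^ 2 * t) : ℝ) : ℂ)) (s := s)
    (fun n => Or.inr (by positivity)) (by linarith)
    (fun t ht => by
      have ht' : 0 < t := ht
      have := Complex.hasSum_ofReal.2 (hasSum_halfTheta_mul t (c ^ 2 * t) ht' (by positivity))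
      convert this using 2 with p
      rw [one_mul, ← Real.exp_add]
      congr 2
      ring) hsum
  rw [mellin_halfTheta_mul hL hs] at h
  have h2 := h.mul_left (Complex.Gamma s)⁻¹
  rw [inv_mul_cancel_left₀ hG] at h2
  refine h2.congr_fun fun p => ?_
  rw [Complex.cpow_neg]
  field_simp

theorem meromorphic_riemannZeta : Meromorphic riemannZeta := by
  intro s
  rcases eq_or_ne s 1 with rfl | hs
  · refine MeromorphicAt.congr (f := fun s => (s - 1)⁻¹ + riemannZeta₀ s)
      (((analyticAt_id.sub analyticAt_const).meromorphicAt.inv).add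
        (differentiable_riemannZeta₀.analyticAt 1).meromorphicAt) ?_
    filter_upwards [self_mem_nhdsWithin] with z hz
    exact (riemannZeta_eq_inv_sub_add hz).symm
  · refine (DifferentiableOn.analyticAt (s := {1}ᶜ) ?_
      (isOpen_compl_singleton.mem_nhds hs)).meromorphicAt
    exact fun z hz => (differentiableAt_riemannZeta hz).differentiableWithinAt

theorem analyticAt_riemannZeta {s : ℂ} (hs : s ≠ 1) : AnalyticAt ℂ riemannZeta s :=
  DifferentiableOn.analyticAt (s := {1}ᶜ)
    (fun _ hz => (differentiableAt_riemannZeta hz).differentiableWithinAt)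
    (isOpen_compl_singleton.mem_nhds hs)

theorem meromorphic_rectangleMellin {L : ℝ} (hL : 0 < L) : Meromorphic (rectangleMellin L) := by
  intro s
  have hs : AnalyticAt ℂ (fun z : ℂ => z - 1 / 2) s := analyticAt_id.sub analyticAt_const
  have hs2 : AnalyticAt ℂ (fun z : ℂ => 2 * (z - 1 / 2)) s := analyticAt_const.mul hs
  refine MeromorphicAt.mul (analyticAt_const.meromorphicAt) (MeromorphicAt.add
    (MeromorphicAt.mul (analyticAt_const.meromorphicAt) (MeromorphicAt.mul ?_ ?_))
    ((differentiable_mellin_thetaKernel hL).analyticAt s).meromorphicAt)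
  · exact (Meromorphic.Gamma _).comp_analyticAt hs
  · exact (meromorphic_riemannZeta _).comp_analyticAt hs2

/-- At `s = 0` Gamma is taken at `-1/2`, which is not a pole because `1` is odd, and zeta at `-1`,
away from its pole. Analyticity of Gamma is read off from the entire function `1/Γ`. -/
theorem analyticAt_rectangleMellin_zero {L : ℝ} (hL : 0 < L) :
    AnalyticAt ℂ (rectangleMellin L) 0 := by
  have hs : AnalyticAt ℂ (fun z : ℂ => z - 1 / 2) 0 := analyticAt_id.sub analyticAt_const
  have hs2 : AnalyticAt ℂ (fun z : ℂ => 2 * (z - 1 / 2)) 0 := analyticAt_const.mul hs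
  refine AnalyticAt.mul analyticAt_const (AnalyticAt.add
    (AnalyticAt.mul analyticAt_const (AnalyticAt.mul ?_ ?_))
    ((differentiable_mellin_thetaKernel hL).analyticAt 0))
  · refine AnalyticAt.fun_comp (g := Complex.Gamma) ?_ hs
    have hG : AnalyticAt ℂ (fun z => (Complex.Gamma z)⁻¹⁻¹) (0 - 1 / 2) := by
      refine (Complex.differentiable_one_div_Gamma.analyticAt _).inv (inv_ne_zero ?_)
      refine Complex.Gamma_ne_zero fun m hm => ?_
      have := congrArg Complex.re hm
      norm_num at this
      have h2 : (1 : ℝ) = 2 * m := by linarith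
      norm_cast at h2
      omega
    simpa using hG
  · exact AnalyticAt.fun_comp (g := riemannZeta) (analyticAt_riemannZeta (by norm_num)) hs2

theorem meromorphic_rectangleZeta {L : ℝ} (hL : 0 < L) : Meromorphic (rectangleZeta L) := by
  intro s
  have hs : AnalyticAt ℂ (fun z : ℂ => 2 * z) s := analyticAt_const.mul analyticAt_id
  exact (analyticAt_const.meromorphicAt.mul
    ((meromorphic_riemannZeta _).comp_analyticAt hs)).add
    ((Meromorphic.Gamma s).inv.mul (meromorphic_rectangleMellin hL s))

theorem analyticAt_rectangleZeta_zero {L : ℝ} (hL : 0 < L) : AnalyticAt ℂ (rectangleZeta L) 0 := by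
  have hs : AnalyticAt ℂ (fun z : ℂ => 2 * z) 0 := analyticAt_const.mul analyticAt_id
  exact (analyticAt_const.mul (AnalyticAt.fun_comp (g := riemannZeta)
    (analyticAt_riemannZeta (by norm_num)) hs)).add
    ((Complex.differentiable_one_div_Gamma.analyticAt 0).mul (analyticAt_rectangleMellin_zero hL))

/-- Product rule for `1/Γ(s) = s · 1/Γ(s + 1)`, with `Γ(1) = 1`. -/
theorem hasDerivAt_inv_Gamma_zero : HasDerivAt (fun s => (Complex.Gamma s)⁻¹) 1 0 := by
  have h := (hasDerivAt_id (0 : ℂ)).mul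
    ((Complex.differentiable_one_div_Gamma.comp (differentiable_id.add_const 1)) 0).hasDerivAt
  simp only [id, Function.comp, zero_add, Complex.Gamma_one, inv_one, mul_one, zero_mul,
    add_zero] at h
  refine h.congr_of_eventuallyEq (Eventually.of_forall fun s => ?_)
  exact Complex.one_div_Gamma_eq_self_mul_one_div_Gamma_add_one s

theorem hasDerivAt_riemannZeta_two_mul_zero :
    HasDerivAt (fun s => riemannZeta (2 * s)) (-Complex.log (2 * Real.pi)) 0 := by
  have h1 : HasDerivAt riemannZeta (-Complex.log (2 * Real.pi) / 2) (2 * 0) := by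
    rw [mul_zero, ← deriv_riemannZeta_zero]
    exact (differentiableAt_riemannZeta (by norm_num)).hasDerivAt
  have h2 : HasDerivAt (fun s : ℂ => 2 * s) 2 0 := by
    simpa using (hasDerivAt_id (0 : ℂ)).const_mul 2
  have := HasDerivAt.comp (0 : ℂ) h1 h2
  rwa [div_mul_cancel₀ _ (two_ne_zero)] at this

theorem riemannZeta_neg_one : riemannZeta (-1) = -1 / 12 := by
  have := riemannZeta_neg_nat_eq_bernoulli 1
  rw [Nat.cast_one] at this
  rw [this, bernoulli_two]
  norm_num

theorem Gamma_neg_one_half : Complex.Gamma (-(1 / 2)) = -2 * √Real.pi := by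
  have h := Complex.Gamma_add_one (-(1 / 2)) (by norm_num)
  have e : (-(1 / 2) + 1 : ℂ) = 1 / 2 := by norm_num
  rw [e, Complex.Gamma_one_half_eq] at h
  have e2 : ((Real.pi : ℂ)) ^ (1 / 2 : ℂ) = (√Real.pi : ℝ) := by
    rw [Real.sqrt_eq_rpow, Complex.ofReal_cpow Real.pi_pos.le]; norm_num
  rw [e2] at h
  linear_combination 2 * h

/-- The term `L/12`, and with it the exponent of `δ ^ (1/12)`, is `L/√π · ½ · Γ(-1/2) ζ(-1)`. -/
theorem rectangleMellin_zero (L : ℝ) : rectangleMellin L 0 =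
    (L / 12 : ℝ) + (L / √Real.pi : ℝ) * mellin (thetaKernel L) 0 := by
  have hpi : (√Real.pi : ℂ) ≠ 0 := by
    exact_mod_cast (Real.sqrt_pos.2 Real.pi_pos).ne'
  have e : (2 * (0 - 1 / 2) : ℂ) = -1 := by norm_num
  rw [rectangleMellin, e, zero_sub, Gamma_neg_one_half, riemannZeta_neg_one]
  push_cast
  field_simp

theorem hasDerivAt_rectangleZeta_zero {L : ℝ} (hL : 0 < L) : HasDerivAt (rectangleZeta L)
    (1 / 2 * Complex.log (2 * Real.pi) + rectangleMellin L 0) 0 := by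
  have h := (hasDerivAt_riemannZeta_two_mul_zero.const_mul (-(1 / 2) : ℂ)).add
    (hasDerivAt_inv_Gamma_zero.mul (analyticAt_rectangleMellin_zero hL).differentiableAt.hasDerivAt)
  -- The conventions `Complex.Gamma 0 = 0` and `0⁻¹ = 0` give `1/Γ` its true value at `0`, so the
  -- derivative of `rectangleMellin` drops out and only its value remains.
  simp only [Complex.Gamma_zero, inv_zero, zero_mul, add_zero, one_mul] at h
  refine h.congr_deriv ?_
  ring

end RectangleZeta

end SpectralDet

namespace SpectralDet

/-! ### A Bessel integral of half-integer order -/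

noncomputable section BesselIntegral

/-- The integral of `exp (-v²)` from `0` to `u`. -/
def gaussPrimitive (u : ℝ) : ℝ := ∫ v in (0 : ℝ)..u, Real.exp (-v ^ 2)

theorem hasDerivAt_gaussPrimitive (u : ℝ) : HasDerivAt gaussPrimitive (Real.exp (-u ^ 2)) u :=
  intervalIntegral.integral_hasDerivAt_right
    (Continuous.intervalIntegrable (by fun_prop) _ _)
    (Continuous.stronglyMeasurableAtFilter (by fun_prop) _ _)
    (Continuous.continuousAt (by fun_prop))

theorem gaussPrimitive_neg (u : ℝ) : gaussPrimitive (-u) = -gaussPrimitive u := by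
  have h := intervalIntegral.integral_comp_neg (a := 0) (b := u) fun v : ℝ => Real.exp (-v ^ 2)
  simp only [neg_sq, neg_zero] at h
  rw [gaussPrimitive, gaussPrimitive, intervalIntegral.integral_symm, h]

theorem tendsto_gaussPrimitive_atTop : Tendsto gaussPrimitive atTop (𝓝 (√Real.pi / 2)) := by
  have h := integral_gaussian_Ioi 1
  simp only [neg_mul, one_mul, div_one] at h
  rw [← h]
  refine intervalIntegral_tendsto_integral_Ioi 0 ?_ tendsto_id
  have := (integrable_exp_neg_mul_sq (b := 1) one_pos).integrableOn (s := Ioi 0)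
  simpa using this

theorem tendsto_gaussPrimitive_atBot : Tendsto gaussPrimitive atBot (𝓝 (-(√Real.pi / 2))) := by
  have := (tendsto_gaussPrimitive_atTop.comp tendsto_neg_atBot_atTop).neg
  refine this.congr fun u => ?_
  simp [gaussPrimitive_neg]

variable {a b : ℝ}

/-- Completing the square, `(a√t ∓ b/√t)² = a² t + b²/t ∓ 2ab`, so with the weights `exp (∓2ab)`
both Gaussians become the same exponential. The inner derivatives are `±a/(2√t) + b/(2 t√t)`; in the
sum the `a` terms cancel and `b t ^ (-3/2)` is left. -/
theorem hasDerivAt_bessel (hb : 0 < b) {t : ℝ} (ht : 0 < t) :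
    HasDerivAt (fun t => (1 / b) * (Real.exp (-(2 * a * b)) * gaussPrimitive (a * √t - b / √t) +
      Real.exp (2 * a * b) * gaussPrimitive (-a * √t - b / √t)))
      (t ^ (-(3 / 2) : ℝ) * Real.exp (-(a ^ 2 * t + b ^ 2 / t))) t := by
  have hs : 0 < √t := Real.sqrt_pos.2 ht
  have h1 := Real.hasDerivAt_sqrt ht.ne'
  have h2 : HasDerivAt (fun t => b / √t) (-(b * (1 / (2 * √t))) / √t ^ 2) t := by
    simpa using (hasDerivAt_const t b).fun_div h1 hs.ne'
  have h3 := fun c : ℝ => (h1.const_mul c).sub h2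
  have h4 := fun c : ℝ => (hasDerivAt_gaussPrimitive _).comp t (h3 c)
  have h5 := (((h4 a).const_mul (Real.exp (-(2 * a * b)))).add
    ((h4 (-a)).const_mul (Real.exp (2 * a * b)))).const_mul (1 / b)
  refine h5.congr_deriv ?_
  have e1 : Real.exp (-(a * √t - b / √t) ^ 2) =
      Real.exp (2 * a * b) * Real.exp (-(a ^ 2 * t + b ^ 2 / t)) := by
    rw [← Real.exp_add]
    congr 1
    rw [sub_sq, mul_pow, div_pow, Real.sq_sqrt ht.le]
    field_simp
    ring
  have e2 : Real.exp (-(-a * √t - b / √t) ^ 2) =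
      Real.exp (-(2 * a * b)) * Real.exp (-(a ^ 2 * t + b ^ 2 / t)) := by
    rw [← Real.exp_add]
    congr 1
    rw [sub_sq, mul_pow, div_pow, Real.sq_sqrt ht.le]
    field_simp
    ring
  have e3 : t ^ (-(3 / 2) : ℝ) = (√t ^ 3)⁻¹ := by
    rw [Real.rpow_neg ht.le, Real.sqrt_eq_rpow, ← Real.rpow_mul_natCast ht.le]
    norm_num
  have e4 : Real.exp (2 * a * b) * Real.exp (-(2 * a * b)) = 1 := by
    rw [← Real.exp_add]; simp
  simp only [Pi.sub_apply, e1, e2, e3]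
  generalize Real.exp (2 * a * b) = E at *
  generalize Real.exp (-(2 * a * b)) = E' at *
  generalize Real.exp (-(a ^ 2 * t + b ^ 2 / t)) = F
  generalize √t = r at *
  field_simp
  linear_combination 2 * F * b * e4

/-- The increment of the antiderivative over `(0, ∞)`: the argument `a√t - b/√t` runs from `-∞` to
`+∞` and contributes the full Gaussian integral `√π`, while `-a√t - b/√t` tends to `-∞` at both ends
and contributes nothing. Integrability follows from the sign of the integrand. -/
theorem besselIntegral (ha : 0 < a) (hb : 0 < b) :
    IntegrableOn (fun t => t ^ (-(3 / 2) : ℝ) * Real.exp (-(a ^ 2 * t + b ^ 2 / t))) (Ioi 0) ∧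
    ∫ t in Ioi 0, t ^ (-(3 / 2) : ℝ) * Real.exp (-(a ^ 2 * t + b ^ 2 / t)) =
      √Real.pi / b * Real.exp (-(2 * a * b)) := by
  set F : ℝ → ℝ := fun t => (1 / b) * (Real.exp (-(2 * a * b)) * gaussPrimitive (a * √t - b / √t) +
      Real.exp (2 * a * b) * gaussPrimitive (-a * √t - b / √t)) with hF
  have hinf : Tendsto (fun t : ℝ => √t) atTop atTop := Real.tendsto_sqrt_atTop
  have hdiv : Tendsto (fun t : ℝ => -(b / √t)) atTop (𝓝 (-0)) :=
    (hinf.const_div_atTop b).neg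
  have hz : Tendsto (fun t : ℝ => √t) (𝓝[>] 0) (𝓝[>] 0) := by
    refine tendsto_nhdsWithin_iff.2 ⟨?_, ?_⟩
    · have := (Real.continuous_sqrt.tendsto 0).mono_left (nhdsWithin_le_nhds (s := Ioi 0))
      simpa using this
    · filter_upwards [self_mem_nhdsWithin] with t ht
      exact Real.sqrt_pos.2 ht
  have hbz : Tendsto (fun t : ℝ => -(b / √t)) (𝓝[>] 0) atBot := by
    refine tendsto_neg_atTop_atBot.comp ?_
    simp only [div_eq_mul_inv]
    exact (tendsto_inv_nhdsGT_zero.comp hz).const_mul_atTop hb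
  have l1 : Tendsto F atTop (𝓝 ((1 / b) * (Real.exp (-(2 * a * b)) * (√Real.pi / 2) +
      Real.exp (2 * a * b) * (-(√Real.pi / 2))))) := by
    refine ((tendsto_gaussPrimitive_atTop.comp ?_).const_mul _ |>.add
      ((tendsto_gaussPrimitive_atBot.comp ?_).const_mul _)).const_mul _
    · simp only [sub_eq_add_neg]
      exact (hinf.const_mul_atTop ha).atTop_add hdiv
    · simp only [sub_eq_add_neg]
      exact (hinf.const_mul_atTop_of_neg (neg_neg_of_pos ha)).atBot_add hdiv
  have l2 : Tendsto F (𝓝[>] 0) (𝓝 ((1 / b) * (Real.exp (-(2 * a * b)) * (-(√Real.pi / 2)) +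
      Real.exp (2 * a * b) * (-(√Real.pi / 2))))) := by
    have hc := fun c : ℝ => (hz.mono_right nhdsWithin_le_nhds).const_mul c
    refine ((tendsto_gaussPrimitive_atBot.comp ?_).const_mul _ |>.add
      ((tendsto_gaussPrimitive_atBot.comp ?_).const_mul _)).const_mul _
    · simp only [sub_eq_add_neg]
      exact (hc a).add_atBot hbz
    · simp only [sub_eq_add_neg]
      exact (hc (-a)).add_atBot hbz
  set m := (1 / b) * (Real.exp (-(2 * a * b)) * (-(√Real.pi / 2)) +
      Real.exp (2 * a * b) * (-(√Real.pi / 2))) with hm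
  -- `F` is meaningless at `0`, where it divides by zero; its value there is replaced by its right
  -- limit.
  have hcont : ContinuousWithinAt (Function.update F 0 m) (Ici 0) 0 := by
    rw [continuousWithinAt_update_same, Ici_sdiff_left]
    exact l2
  have hd : ∀ t ∈ Ioi (0 : ℝ), HasDerivAt (Function.update F 0 m)
      (t ^ (-(3 / 2) : ℝ) * Real.exp (-(a ^ 2 * t + b ^ 2 / t))) t := fun t ht => by
    refine (hasDerivAt_bessel hb ht).congr_of_eventuallyEq ?_
    filter_upwards [Ioi_mem_nhds ht] with x hx
    rw [Function.update_of_ne (ne_of_gt hx)]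
  have hpos : ∀ t ∈ Ioi (0 : ℝ), 0 ≤ t ^ (-(3 / 2) : ℝ) * Real.exp (-(a ^ 2 * t + b ^ 2 / t)) :=
    fun t ht => mul_nonneg (Real.rpow_nonneg (le_of_lt ht) _) (Real.exp_pos _).le
  have l3 := l1.congr' (f₂ := Function.update F 0 m) (by
    filter_upwards [eventually_gt_atTop 0] with x hx
    rw [Function.update_of_ne (ne_of_gt hx)])
  refine ⟨integrableOn_Ioi_deriv_of_nonneg hcont hd hpos l3, ?_⟩
  rw [integral_Ioi_of_hasDerivAt_of_nonneg hcont hd hpos l3, Function.update_self, hm]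
  ring

end BesselIntegral

end SpectralDet

/-! ### Closed forms for the two determinants of the rectangle -/

namespace SpectralDet

noncomputable section RectangleDet

/-- Expand each logarithm in powers of `r ^ (n + 1)`. The double series is dominated by a product of
geometric series, since `(n + 1)(k + 1) ≥ n + k`. -/
theorem hasSum_neg_log_one_sub {r : ℝ} (h0 : 0 < r) (h1 : r < 1) :
    Summable (fun n : ℕ => -Real.log (1 - r ^ (n + 1))) ∧
    HasSum (fun p : ℕ × ℕ => r ^ ((p.1 + 1) * (p.2 + 1)) / (p.2 + 1 : ℝ))
      (∑' n : ℕ, -Real.log (1 - r ^ (n + 1))) := by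
  have hs : Summable fun p : ℕ × ℕ => r ^ ((p.1 + 1) * (p.2 + 1)) / (p.2 + 1 : ℝ) := by
    have hg := summable_geometric_of_lt_one h0.le h1
    refine Summable.of_nonneg_of_le (fun p => by positivity) (fun p => ?_)
      (hg.mul_of_nonneg hg (fun _ => by positivity) fun _ => by positivity)
    rw [← pow_add]
    refine (div_le_self (by positivity) (by linarith [Nat.cast_nonneg (α := ℝ) p.2])).trans ?_
    exact pow_le_pow_of_le_one h0.le h1.le (by nlinarith)
  have h2 : ∀ n : ℕ, HasSum (fun k : ℕ => r ^ ((n + 1) * (k + 1)) / (k + 1 : ℝ))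
      (-Real.log (1 - r ^ (n + 1))) := fun n => by
    have h3 : |r ^ (n + 1)| < 1 := by
      rw [abs_of_nonneg (by positivity)]
      exact pow_lt_one₀ h0.le h1 (by omega)
    simpa only [← pow_mul] using Real.hasSum_pow_div_log_of_abs_lt_one h3
  have h3 := hs.hasSum.prod_fiberwise h2
  exact ⟨h3.summable, h3.tsum_eq.symm ▸ hs.hasSum⟩

/-- At `s = 0` the integrand is `t ^ (-3/2) θ(t) θ(L²/t)`. Expanding both thetas gives Bessel
integrals with `a = n`, `b = k L`, equal to `√π/(kL) · exp (-2nkL)`; summing over `k` produces the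
logarithms. -/
theorem mellin_thetaKernel_zero {L : ℝ} (hL : 0 < L) :
    mellin (thetaKernel L) 0 =
      (√Real.pi / L * ∑' n : ℕ, -Real.log (1 - Real.exp (-(2 * L)) ^ (n + 1)) : ℝ) := by
  set f : ℕ × ℕ → ℝ → ℝ := fun p t => t ^ (-(3 / 2) : ℝ) *
    Real.exp (-((p.1 + 1 : ℝ) ^ 2 * t + ((p.2 + 1) * L) ^ 2 / t)) with hf
  have hb := fun p : ℕ × ℕ => besselIntegral (a := (p.1 + 1 : ℝ)) (b := (p.2 + 1) * L)
    (by positivity) (by positivity)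
  have hval : ∀ p : ℕ × ℕ, √Real.pi / ((p.2 + 1) * L) *
      Real.exp (-(2 * (p.1 + 1 : ℝ) * ((p.2 + 1) * L))) = √Real.pi / L *
      (Real.exp (-(2 * L)) ^ ((p.1 + 1) * (p.2 + 1)) / (p.2 + 1 : ℝ)) := fun p => by
    rw [← Real.exp_nat_mul]
    push_cast
    field_simp
  have hsum := (hasSum_neg_log_one_sub (Real.exp_pos (-(2 * L)))
    (by rw [Real.exp_lt_one_iff]; linarith)).2.mul_left (√Real.pi / L)
  have hnn : ∀ p, ∀ t ∈ Ioi (0 : ℝ), 0 ≤ f p t := fun p t ht =>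
    mul_nonneg (Real.rpow_nonneg (le_of_lt ht) _) (Real.exp_pos _).le
  have hnorm : ∀ p, ∫ t in Ioi 0, ‖f p t‖ = ∫ t in Ioi 0, f p t := fun p =>
    setIntegral_congr_fun measurableSet_Ioi fun t ht => Real.norm_of_nonneg (hnn p t ht)
  -- Sum and integral may be exchanged because the terms are nonnegative and their integrals are
  -- summable.
  have hint := hasSum_integral_of_summable_integral_norm (μ := volume.restrict (Ioi 0))
    (F := f) (fun p => (hb p).1) (by
      refine hsum.summable.congr fun p => ?_
      rw [hnorm, hf, (hb p).2, hval])
  simp only [hf, (hb _).2, hval] at hint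
  have hfin := hint.unique hsum
  rw [← hfin, ← integral_complex_ofReal, mellin]
  refine setIntegral_congr_fun measurableSet_Ioi fun t (ht : 0 < t) => ?_
  have h1 := (hasSum_halfTheta_mul t (L ^ 2 / t) ht (by positivity)).mul_left (t ^ (-(3 / 2) : ℝ))
  have h2 : ∀ p : ℕ × ℕ, t ^ (-(3 / 2) : ℝ) * (Real.exp (-((p.1 + 1 : ℝ) ^ 2 * t)) *
      Real.exp (-((p.2 + 1 : ℝ) ^ 2 * (L ^ 2 / t)))) = t ^ (-(3 / 2) : ℝ) *
    Real.exp (-((p.1 + 1 : ℝ) ^ 2 * t + ((p.2 + 1) * L) ^ 2 / t)) := fun p => by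
    rw [← Real.exp_add]
    congr 2
    ring
  simp only [h2] at h1
  simp only [h1.tsum_eq, thetaKernel, smul_eq_mul]
  have ht0 : (t : ℂ) ≠ 0 := Complex.ofReal_ne_zero.2 ht.ne'
  rw [Complex.ofReal_mul (t ^ (-(3 / 2) : ℝ)), Complex.ofReal_cpow ht.le, ← mul_assoc,
    ← Complex.cpow_add _ _ ht0]
  norm_num

theorem exp_neg_deriv_rectangleZeta {δ : ℝ} (h0 : 0 < δ) (h1 : δ < 1) :
    Multipliable (fun n : ℕ => 1 - δ ^ (2 * (n + 1))) ∧
    ((1 / √(2 * Real.pi) * δ ^ (1 / 12 : ℝ) * ∏' n : ℕ, (1 - δ ^ (2 * (n + 1))) : ℝ) : ℂ) =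
      Complex.exp (-deriv (rectangleZeta (-Real.log δ)) 0) := by
  have hL : 0 < -Real.log δ := neg_pos.2 (Real.log_neg h0 h1)
  have hr : Real.exp (-(2 * -Real.log δ)) = δ ^ 2 := by
    rw [mul_neg, neg_neg, ← Nat.cast_ofNat, Real.exp_nat_mul, Real.exp_log h0]
  have hs := (hasSum_neg_log_one_sub (pow_pos h0 2) (pow_lt_one₀ h0.le h1 two_ne_zero)).1
  simp only [← pow_mul] at hs
  have hs' : Summable fun n : ℕ => Real.log (1 - δ ^ (2 * (n + 1))) := by simpa using hs.neg
  have hpos : ∀ n : ℕ, 0 < 1 - δ ^ (2 * (n + 1)) := fun n =>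
    sub_pos.2 (pow_lt_one₀ h0.le h1 (by omega))
  refine ⟨Real.multipliable_of_summable_log hpos hs', ?_⟩
  have hpi : (0 : ℝ) < √Real.pi := Real.sqrt_pos.2 Real.pi_pos
  have hlog : Complex.log (2 * Real.pi) = (Real.log (2 * Real.pi) : ℝ) := by
    rw [Complex.ofReal_log (by positivity)]
    push_cast
    rfl
  rw [(hasDerivAt_rectangleZeta_zero hL).deriv, rectangleMellin_zero, mellin_thetaKernel_zero hL,
    hr, hlog, ← Real.rexp_tsum_eq_tprod hpos hs']
  simp only [← pow_mul, tsum_neg]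
  have e1 : 1 / √(2 * Real.pi) = Real.exp (-(1 / 2 * Real.log (2 * Real.pi))) := by
    rw [Real.exp_neg, mul_comm (1 / 2 : ℝ), Real.exp_mul, Real.exp_log (by positivity), ← Real.sqrt_eq_rpow,
      one_div]
  have e2 : δ ^ (1 / 12 : ℝ) = Real.exp (Real.log δ * (1 / 12)) := Real.rpow_def_of_pos h0 _
  have e3 : ∀ S : ℝ, -Real.log δ / √Real.pi * (√Real.pi / -Real.log δ * S) = S := fun S => by
    rw [← mul_assoc, div_mul_div_cancel₀ hpi.ne', div_self hL.ne', one_mul]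
  rw [e1, e2, ← Real.exp_add, ← Real.exp_add, Complex.ofReal_exp, ← Complex.ofReal_mul, e3]
  congr 1
  push_cast
  ring

/-- The zeta function of the Laplacian on a rectangle of sides `L` and `π`, with Dirichlet
condition on the sides of length `π` and Neumann condition on the others. -/
def mixedRectangleZeta (L : ℝ) (s : ℂ) : ℂ :=
  rectangleZeta L s + ((Real.pi / L : ℝ) : ℂ) ^ (-(2 * s)) * riemannZeta (2 * s)

/-- The row `p.1 = 0` is a rescaled Riemann zeta series; the other rows are the Dirichlet spectrum
shifted by one. -/
theorem hasSum_mixedRectangleZeta {L : ℝ} (hL : 0 < L) {s : ℂ} (hs : 2 < s.re) :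
    HasSum (fun p : ℕ × ℕ =>
      (((p.1 : ℝ) ^ 2 + (Real.pi / L * (p.2 + 1)) ^ 2 : ℝ) : ℂ) ^ (-s))
      (mixedRectangleZeta L s) := by
  have h1 := hasSum_rectangleZeta hL hs
  have hz : 1 < (2 * s).re := by simp; linarith
  have h2 : HasSum (fun n : ℕ => ((Real.pi / L : ℝ) : ℂ) ^ (-(2 * s)) * (1 / ((n : ℂ) + 1) ^ (2 * s)))
      (((Real.pi / L : ℝ) : ℂ) ^ (-(2 * s)) * riemannZeta (2 * s)) := by
    rw [zeta_eq_tsum_one_div_nat_add_one_cpow hz]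
    refine (Summable.hasSum ?_).mul_left _
    have := (summable_nat_add_iff 1).2 (Complex.summable_one_div_nat_cpow.2 hz)
    simpa using this
  have h3 : HasSum (fun p : ℕ × ℕ => if p.1 = 0 then
      (((p.1 : ℝ) ^ 2 + (Real.pi / L * (p.2 + 1)) ^ 2 : ℝ) : ℂ) ^ (-s) else 0)
      (((Real.pi / L : ℝ) : ℂ) ^ (-(2 * s)) * riemannZeta (2 * s)) := by
    have hinj : Function.Injective (fun n : ℕ => ((0 : ℕ), n)) := fun a b h => by simpa using h
    refine (hinj.hasSum_iff ?_).1 (h2.congr_fun fun n => ?_)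
    · rintro ⟨a, b⟩ h
      refine if_neg fun h' => h ⟨b, ?_⟩
      simp_all
    · simp only [Function.comp, if_true, Nat.cast_zero, ne_eq, OfNat.ofNat_ne_zero,
        not_false_eq_true, zero_pow, zero_add]
      rw [ofReal_sq_cpow (by positivity), Complex.ofReal_mul,
        Complex.mul_cpow_ofReal_nonneg (by positivity) (by positivity), mul_neg, one_div,
        Complex.cpow_neg ((n + 1 : ℝ) : ℂ)]
      push_cast
      rfl
  have h4 : HasSum (fun p : ℕ × ℕ => if p.1 = 0 then 0 else
      (((p.1 : ℝ) ^ 2 + (Real.pi / L * (p.2 + 1)) ^ 2 : ℝ) : ℂ) ^ (-s)) (rectangleZeta L s) := by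
    have hinj : Function.Injective (fun p : ℕ × ℕ => (p.1 + 1, p.2)) := fun a b h => by
      simpa [Prod.ext_iff] using h
    refine (hinj.hasSum_iff ?_).1 (h1.congr_fun fun n => ?_)
    · rintro ⟨a, b⟩ h
      refine if_pos ?_
      by_contra h'
      exact h ⟨(a - 1, b), by simp; omega⟩
    · simp
  refine (h4.add h3).congr_fun fun p => ?_
  split_ifs <;> simp

theorem analyticAt_mixedRectangleZeta_aux {L : ℝ} (hL : 0 < L) :
    Differentiable ℂ fun s : ℂ => ((Real.pi / L : ℝ) : ℂ) ^ (-(2 * s)) := by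
  have hc : ((Real.pi / L : ℝ) : ℂ) ≠ 0 := Complex.ofReal_ne_zero.2 (by positivity)
  intro s
  exact (DifferentiableAt.const_cpow (by fun_prop) (Or.inl hc))

theorem meromorphic_mixedRectangleZeta {L : ℝ} (hL : 0 < L) :
    Meromorphic (mixedRectangleZeta L) := by
  intro s
  have hs : AnalyticAt ℂ (fun z : ℂ => 2 * z) s := analyticAt_const.mul analyticAt_id
  exact (meromorphic_rectangleZeta hL s).add
    (((analyticAt_mixedRectangleZeta_aux hL).analyticAt s).meromorphicAt.mul
      ((meromorphic_riemannZeta _).comp_analyticAt hs))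

theorem analyticAt_mixedRectangleZeta_zero {L : ℝ} (hL : 0 < L) :
    AnalyticAt ℂ (mixedRectangleZeta L) 0 := by
  have hs : AnalyticAt ℂ (fun z : ℂ => 2 * z) 0 := analyticAt_const.mul analyticAt_id
  exact (analyticAt_rectangleZeta_zero hL).add
    (((analyticAt_mixedRectangleZeta_aux hL).analyticAt 0).mul
      (AnalyticAt.fun_comp (g := riemannZeta) (analyticAt_riemannZeta (by norm_num)) hs))

/-- With `ζ(0) = -1/2` and `ζ'(0) = -½ log 2π`, the extra term `(π/L)^{-2s} ζ(2s)` has derivative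
`log (π/L) - log 2π = -log 2L` at `0`. -/
theorem deriv_mixedRectangleZeta_zero {L : ℝ} (hL : 0 < L) :
    deriv (mixedRectangleZeta L) 0 = deriv (rectangleZeta L) 0 - (Real.log (2 * L) : ℝ) := by
  have hc : ((Real.pi / L : ℝ) : ℂ) ≠ 0 := Complex.ofReal_ne_zero.2 (by positivity)
  have h1 : HasDerivAt (fun s : ℂ => -(2 * s)) (-2) 0 := by
    simpa using ((hasDerivAt_id (0 : ℂ)).const_mul 2).fun_neg
  have h2 := (h1.const_cpow (c := ((Real.pi / L : ℝ) : ℂ)) (Or.inl hc)).mul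
    hasDerivAt_riemannZeta_two_mul_zero
  have h3 := (analyticAt_rectangleZeta_zero hL).differentiableAt.hasDerivAt.add h2
  refine h3.deriv.trans ?_
  have hlog : Complex.log (2 * Real.pi) = (Real.log (2 * Real.pi) : ℝ) := by
    rw [Complex.ofReal_log (by positivity)]
    push_cast
    rfl
  rw [hlog, ← Complex.ofReal_log (by positivity), Real.log_div (by positivity) hL.ne',
    Real.log_mul two_ne_zero Real.pi_ne_zero, Real.log_mul two_ne_zero hL.ne']
  simp only [mul_zero, neg_zero, Complex.cpow_zero, riemannZeta_zero]
  push_cast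
  ring

theorem exp_neg_deriv_mixedRectangleZeta {δ : ℝ} (h0 : 0 < δ) (h1 : δ < 1) :
    ((-√(2 / Real.pi) * Real.log δ * δ ^ (1 / 12 : ℝ) * ∏' n : ℕ, (1 - δ ^ (2 * (n + 1))) : ℝ) : ℂ)
      = Complex.exp (-deriv (mixedRectangleZeta (-Real.log δ)) 0) := by
  have hL : 0 < -Real.log δ := neg_pos.2 (Real.log_neg h0 h1)
  rw [deriv_mixedRectangleZeta_zero hL, neg_sub, sub_eq_add_neg, Complex.exp_add,
    ← (exp_neg_deriv_rectangleZeta h0 h1).2, ← Complex.ofReal_exp, Real.exp_log (by linarith),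
    ← Complex.ofReal_mul]
  congr 1
  have e : √(2 / Real.pi) = 2 * (1 / √(2 * Real.pi)) := by
    rw [Real.sqrt_eq_iff_mul_self_eq_of_pos (by positivity)]
    have := Real.mul_self_sqrt (by positivity : 0 ≤ 2 * Real.pi)
    field_simp
    rw [Real.sq_sqrt (by positivity)]
  rw [e]
  ring

end RectangleDet

end SpectralDet

namespace SpectralDet

/-! ### Self-adjointness from an eigenbasis -/

section SelfAdjoint

variable {H : Type*} [NormedAddCommGroup H] [InnerProductSpace ℂ H] [CompleteSpace H]

/-- Pairing an element `(y, z)` of the graph of the adjoint with the eigenvectors gives `z_i = l_i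
y_i`. So `(y, z)` is the limit of the partial sums of `∑ y_i (b i, l_i b i)`, which lie in the graph
of `A`, and the graph is closed. The reverse inclusion is symmetry. -/
theorem isSelfAdjoint_of_hilbertBasis {ι : Type*} (A : H →ₗ.[ℂ] H) (b : HilbertBasis ι ℂ H)
    (l : ι → ℝ) (hb : ∀ i, ((b i : H), (l i : ℂ) • (b i : H)) ∈ A.graph)
    (hsymm : ∀ p ∈ A.graph, ∀ q ∈ A.graph, inner ℂ p.2 q.1 = inner ℂ p.1 q.2)
    (hclosed : IsClosed (A.graph : Set (H × H))) : IsSelfAdjoint A := by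
  have hdense : Dense (A.domain : Set H) := by
    have h : Submodule.span ℂ (range b) ≤ A.domain := by
      rw [Submodule.span_le]
      rintro _ ⟨i, rfl⟩
      exact LinearPMap.mem_domain_of_mem_graph (hb i)
    exact (Submodule.dense_iff_topologicalClosure_eq_top.2 b.dense_span).mono h
  rw [LinearPMap.isSelfAdjoint_def]
  refine le_antisymm ?_ ?_
  · refine LinearPMap.le_of_le_graph ?_
    rintro ⟨y, z⟩ hyz
    have hcoef : ∀ i, b.repr z i = l i * b.repr y i := fun i => by
      rw [b.repr_apply_apply, b.repr_apply_apply]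
      obtain ⟨y', rfl, rfl⟩ := (LinearPMap.mem_graph_iff _).1 hyz
      obtain ⟨x', hx', hx⟩ := (LinearPMap.mem_graph_iff _).1 (hb i)
      have h := LinearPMap.adjoint_isFormalAdjoint hdense y' x'
      rw [hx, hx', inner_smul_right] at h
      have := congrArg (starRingEnd ℂ) h
      simpa [inner_conj_symm] using this
    have hs : HasSum (fun i => b.repr y i • ((b i : H), (l i : ℂ) • (b i : H))) (y, z) := by
      have := (b.hasSum_repr y).prodMk (b.hasSum_repr z)
      refine this.congr_fun fun i => ?_
      rw [hcoef, Prod.smul_mk, smul_smul, mul_comm]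
    exact hclosed.mem_of_tendsto hs (Eventually.of_forall fun s =>
      Submodule.sum_mem _ fun i _ => Submodule.smul_mem _ _ (hb i))
  · refine LinearPMap.IsFormalAdjoint.le_adjoint hdense fun x y => ?_
    exact hsymm _ (LinearPMap.mem_graph A x) _ (LinearPMap.mem_graph A y)

end SelfAdjoint

/-! ### Symmetry and closedness of the graph of the Laplacian -/

section LaplacianGraph

variable {Ω : Set ℂ} {ρ : ℂ → ℝ} {D : Set ℂ}

theorem laplacianGraph_symm {p q : L2 Ω ρ × L2 Ω ρ} (hp : p ∈ laplacianGraph Ω ρ D)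
    (hq : q ∈ laplacianGraph Ω ρ D) : inner ℂ p.2 q.1 = inner ℂ p.1 q.2 := by
  obtain ⟨w, hw, h⟩ := hp
  obtain ⟨x, hx, k⟩ := hq
  rw [← k _ hw, ← inner_conj_symm p.2 q.1, ← h _ hx, map_add, inner_conj_symm, inner_conj_symm]

/-- Testing the weak equation against `u` itself gives `‖∇u‖² = ⟨u, f⟩ ≤ ‖u‖ ‖f‖`. Hence the
gradients along a convergent sequence of the graph are Cauchy, and the weak equation passes to the
limit. -/
theorem isClosed_laplacianGraph : IsClosed (laplacianGraph Ω ρ D : Set (L2 Ω ρ × L2 Ω ρ)) := by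
  have hbound : ∀ q : L2 Ω ρ × L2 Ω ρ, ∀ w : L2 Ω ρ × L2 Ω ρ, (q.1, w) ∈ gradGraph Ω ρ D →
      (∀ p ∈ gradGraph Ω ρ D, inner ℂ p.2.1 w.1 + inner ℂ p.2.2 w.2 = inner ℂ p.1 q.2) →
      ‖w‖ ≤ ‖q‖ := by
    intro q w hw h
    have h1 := congrArg Complex.re (h _ hw)
    simp only [inner_self_eq_norm_sq_to_K] at h1
    have h2 : ‖w.1‖ ^ 2 + ‖w.2‖ ^ 2 ≤ ‖q‖ * ‖q‖ := by
      calc ‖w.1‖ ^ 2 + ‖w.2‖ ^ 2 = (inner ℂ q.1 q.2).re := by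
            rw [← h1]
            simp [← Complex.ofReal_pow]
        _ ≤ ‖inner ℂ q.1 q.2‖ := Complex.re_le_norm _
        _ ≤ ‖q.1‖ * ‖q.2‖ := norm_inner_le_norm _ _
        _ ≤ ‖q‖ * ‖q‖ := by
            gcongr
            · exact norm_fst_le q
            · exact norm_snd_le q
    refine norm_prod_le_iff.2 ⟨?_, ?_⟩
    · exact abs_le_of_sq_le_sq' (by nlinarith [sq_nonneg ‖w.2‖]) (norm_nonneg _) |>.2
    · exact abs_le_of_sq_le_sq' (by nlinarith [sq_nonneg ‖w.1‖]) (norm_nonneg _) |>.2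
  refine IsSeqClosed.isClosed fun q q₀ hq hlim => ?_
  choose w hw h using hq
  have hdiff : ∀ k l, ‖w k - w l‖ ≤ ‖q k - q l‖ := fun k l => by
    refine hbound _ _ (sub_mem (hw k) (hw l)) fun p hp => ?_
    simp only [Prod.fst_sub, Prod.snd_sub, inner_sub_right, ← h k p hp, ← h l p hp]
    ring
  have hc : CauchySeq w := by
    rw [Metric.cauchySeq_iff]
    intro ε hε
    obtain ⟨N, hN⟩ := Metric.cauchySeq_iff.1 hlim.cauchySeq ε hε
    refine ⟨N, fun m hm n hn => lt_of_le_of_lt ?_ (hN m hm n hn)⟩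
    rw [dist_eq_norm, dist_eq_norm]
    exact hdiff m n
  obtain ⟨w₀, hw₀⟩ := cauchySeq_tendsto_of_complete hc
  refine ⟨w₀, ?_, fun p hp => ?_⟩
  · exact (Submodule.isClosed_topologicalClosure _).mem_of_tendsto
      (((continuous_fst.tendsto _).comp hlim).prodMk_nhds hw₀) (Eventually.of_forall hw)
  · have h1 : Tendsto (fun k => inner ℂ p.2.1 (w k).1 + inner ℂ p.2.2 (w k).2) atTop
        (𝓝 (inner ℂ p.2.1 w₀.1 + inner ℂ p.2.2 w₀.2)) := by
      have hcont : Continuous fun v : L2 Ω ρ × L2 Ω ρ =>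
          inner ℂ p.2.1 v.1 + inner ℂ p.2.2 v.2 := by fun_prop
      exact (hcont.tendsto _).comp hw₀
    have h2 : Tendsto (fun k => inner ℂ p.1 (q k).2) atTop (𝓝 (inner ℂ p.1 q₀.2)) := by
      have hcont : Continuous fun v : L2 Ω ρ × L2 Ω ρ => inner ℂ p.1 v.2 := by fun_prop
      exact (hcont.tendsto _).comp hlim
    exact tendsto_nhds_unique h1 (h2.congr fun k => (h k p hp).symm)

end LaplacianGraph

end SpectralDet

namespace SpectralDet

/-! ### Logarithmic coordinates on the half-annulus -/

noncomputable section LogCoordinates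

/-- The rectangle which logarithmic coordinates `z = exp (x + i θ)` identify with the
half-annulus. -/
def logRect (δ : ℝ) : Set (ℝ × ℝ) := Ioo (Real.log δ) 0 ×ˢ Ioo 0 Real.pi

/-- Logarithmic coordinates `(x, θ) ↦ exp (x + i θ)`. -/
def polarExp (p : ℝ × ℝ) : ℂ := Complex.exp (p.1 + p.2 * Complex.I)

/-- The Riemannian area measure of the half-annulus. -/
abbrev annulusMeasure (δ : ℝ) : Measure ℂ := areaMeasure (halfAnnulus δ) flatFactor

theorem continuous_polarExp : Continuous polarExp := by unfold polarExp; fun_prop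

theorem norm_polarExp (p : ℝ × ℝ) : ‖polarExp p‖ = Real.exp p.1 := by
  simp [polarExp, Complex.norm_exp]

theorem im_polarExp (p : ℝ × ℝ) : (polarExp p).im = Real.exp p.1 * Real.sin p.2 := by
  simp [polarExp, Complex.exp_im]

theorem det_smul_one (c : ℂ) : (c • (1 : ℂ →L[ℝ] ℂ)).det = ‖c‖ ^ 2 := by
  have : ((c • (1 : ℂ →L[ℝ] ℂ) : ℂ →L[ℝ] ℂ) : ℂ →ₗ[ℝ] ℂ) = Algebra.lmul ℝ ℂ c := by
    ext; simp
  rw [ContinuousLinearMap.det, this, ← Algebra.norm_apply, Algebra.norm_complex_apply,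
    Complex.normSq_eq_norm_sq]

theorem exp_image_strip {δ : ℝ} (h0 : 0 < δ) :
    Complex.exp '' (Ioo (Real.log δ) 0 ×ℂ Ioo 0 Real.pi) = halfAnnulus δ := by
  ext z
  constructor
  · rintro ⟨w, ⟨⟨h1, h2⟩, h3, h4⟩, rfl⟩
    refine ⟨?_, ?_, ?_⟩
    · rw [Complex.norm_exp]
      exact (Real.log_lt_iff_lt_exp h0).1 h1
    · rw [Complex.norm_exp]
      exact Real.exp_lt_one_iff.2 h2
    · rw [Complex.exp_im]
      exact mul_pos (Real.exp_pos _) (Real.sin_pos_of_pos_of_lt_pi h3 h4)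
  · rintro ⟨h1, h2, h3⟩
    have hz : z ≠ 0 := fun h => by simp [h] at h3
    refine ⟨Complex.log z, ⟨⟨?_, ?_⟩, ?_, ?_⟩, Complex.exp_log hz⟩
    · rw [Complex.log_re]
      exact Real.log_lt_log h0 h1
    · rw [Complex.log_re]
      exact Real.log_neg (by positivity) h2
    · rw [Complex.log_im]
      exact (Complex.arg_nonneg_iff.2 h3.le).lt_of_ne' fun h =>
        h3.ne' (Complex.arg_eq_zero_iff.1 h).2
    · rw [Complex.log_im]
      exact Complex.arg_lt_pi_iff.2 (Or.inr h3.ne')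

theorem injOn_exp_strip (δ : ℝ) : InjOn Complex.exp (Ioo (Real.log δ) 0 ×ℂ Ioo 0 Real.pi) := by
  rintro w ⟨-, h1, h2⟩ w' ⟨-, h3, h4⟩ h
  exact Complex.exp_inj_of_neg_pi_lt_of_le_pi (by linarith) h2.le (by linarith) h4.le h

theorem measurableSet_strip (δ : ℝ) :
    MeasurableSet (Ioo (Real.log δ) 0 ×ℂ Ioo 0 Real.pi) :=
  (Complex.measurable_re measurableSet_Ioo).inter (Complex.measurable_im measurableSet_Ioo)

/-- The Jacobian `|exp w|²` of the exponential cancels the conformal factor `1/|z|²`. -/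
theorem measurePreserving_exp {δ : ℝ} (h0 : 0 < δ) :
    MeasurePreserving Complex.exp
      (volume.restrict (Ioo (Real.log δ) 0 ×ℂ Ioo 0 Real.pi)) (annulusMeasure δ) := by
  refine ⟨Complex.measurable_exp, Measure.ext fun s hs => ?_⟩
  rw [Measure.map_apply Complex.measurable_exp hs, annulusMeasure, areaMeasure, withDensity_apply _ hs,
    ← lintegral_indicator hs, ← exp_image_strip h0,
    lintegral_image_eq_lintegral_abs_det_fderiv_mul volume (measurableSet_strip δ)
      (fun w _ => (Complex.hasDerivAt_exp w).complexToReal_fderiv.hasFDerivWithinAt)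
      (injOn_exp_strip δ), ← lintegral_indicator_one (Complex.measurable_exp hs)]
  refine lintegral_congr fun w => ?_
  have hw : 0 < ‖Complex.exp w‖ := norm_pos_iff.2 (Complex.exp_ne_zero w)
  by_cases h : Complex.exp w ∈ s
  · rw [indicator_of_mem (by exact h), indicator_of_mem h, det_smul_one,
      ← ENNReal.ofReal_mul (abs_nonneg _), abs_of_nonneg (by positivity), flatFactor,
      mul_one_div_cancel (by positivity)]
    simp
  · rw [indicator_of_notMem (by exact h), indicator_of_notMem h, mul_zero]

theorem measurePreserving_polarExp {δ : ℝ} (h0 : 0 < δ) :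
    MeasurePreserving polarExp (volume.restrict (logRect δ)) (annulusMeasure δ) := by
  have h := Complex.volume_preserving_equiv_real_prod.symm.restrict_preimage
    (s := Ioo (Real.log δ) 0 ×ℂ Ioo 0 Real.pi) (measurableSet_strip δ)
  have e : Complex.measurableEquivRealProd.symm ⁻¹' (Ioo (Real.log δ) 0 ×ℂ Ioo 0 Real.pi) =
      logRect δ := by
    ext p
    simp [logRect, Complex.mem_reProdIm]
  rw [e] at h
  have h2 := (measurePreserving_exp h0).comp h
  have e2 : polarExp = Complex.exp ∘ Complex.measurableEquivRealProd.symm := by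
    funext p
    simp only [polarExp, Function.comp]
    congr 1
    apply Complex.ext <;> simp
  rwa [e2]

theorem isFiniteMeasure_annulusMeasure {δ : ℝ} (h0 : 0 < δ) :
    IsFiniteMeasure (annulusMeasure δ) := by
  refine ⟨?_⟩
  rw [← (measurePreserving_polarExp h0).measure_preimage nullMeasurableSet_univ, preimage_univ,
    Measure.restrict_apply_univ, logRect, Measure.volume_eq_prod, Measure.prod_prod,
    Real.volume_Ioo, Real.volume_Ioo]
  exact ENNReal.mul_lt_top ENNReal.ofReal_lt_top ENNReal.ofReal_lt_top

theorem ae_mem_halfAnnulus (δ : ℝ) : ∀ᵐ z ∂(annulusMeasure δ), z ∈ halfAnnulus δ :=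
  (withDensity_absolutelyContinuous _ _).ae_le (ae_restrict_mem (isOpen_halfAnnulus δ).measurableSet)

theorem integral_annulusMeasure {δ : ℝ} (h0 : 0 < δ) {f : ℂ → ℂ}
    (hf : AEStronglyMeasurable f (annulusMeasure δ)) :
    ∫ z, f z ∂(annulusMeasure δ) = ∫ p in logRect δ, f (polarExp p) := by
  rw [← (measurePreserving_polarExp h0).map_eq] at hf ⊢
  exact integral_map continuous_polarExp.aemeasurable hf

theorem integrableOn_logRect (δ : ℝ) {g : ℝ × ℝ → ℂ} (hg : Continuous g) :
    IntegrableOn g (logRect δ) :=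
  (hg.continuousOn.integrableOn_compact (isCompact_Icc.prod isCompact_Icc)).mono_set
    (prod_mono (Ioo_subset_Icc_self (a := Real.log δ) (b := 0))
      (Ioo_subset_Icc_self (a := 0) (b := Real.pi)))

theorem integral_logRect {δ : ℝ} (h0 : 0 < δ) (h1 : δ < 1) {g : ℝ × ℝ → ℂ} (hg : Continuous g) :
    ∫ p in logRect δ, g p = ∫ x in Real.log δ..0, ∫ θ in 0..Real.pi, g (x, θ) := by
  have hint := integrableOn_logRect δ hg
  rw [logRect, Measure.volume_eq_prod] at *
  simp only [intervalIntegral.integral_of_le (Real.log_neg h0 h1).le,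
    intervalIntegral.integral_of_le Real.pi_pos.le, integral_Ioc_eq_integral_Ioo]
  exact setIntegral_prod _ hint

theorem integral_logRect_swap {δ : ℝ} (h0 : 0 < δ) (h1 : δ < 1) {g : ℝ × ℝ → ℂ}
    (hg : Continuous g) :
    ∫ p in logRect δ, g p = ∫ θ in 0..Real.pi, ∫ x in Real.log δ..0, g (x, θ) := by
  have hint := integrableOn_logRect δ hg
  rw [integral_logRect h0 h1 hg]
  simp only [intervalIntegral.integral_of_le (Real.log_neg h0 h1).le,
    intervalIntegral.integral_of_le Real.pi_pos.le, integral_Ioc_eq_integral_Ioo]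
  refine integral_integral_swap (f := fun x θ => g (x, θ)) ?_
  rwa [Measure.prod_restrict]

theorem frameDeriv_flatFactor (v : ℂ) (φ : ℂ → ℂ) (z : ℂ) :
    frameDeriv flatFactor v φ z = (‖z‖ : ℂ) * fderiv ℝ φ z v := by
  have : (√(flatFactor z))⁻¹ = ‖z‖ := by
    rw [flatFactor, one_div, Real.sqrt_inv, inv_inv, Real.sqrt_sq (norm_nonneg z)]
  rw [frameDeriv, this]

theorem memLp_annulusMeasure {δ : ℝ} (h0 : 0 < δ) {f : ℂ → ℂ} (hf : Continuous f) :
    MemLp f 2 (annulusMeasure δ) := by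
  have := isFiniteMeasure_annulusMeasure h0
  obtain ⟨C, hC⟩ := (isCompact_closedBall (0 : ℂ) 1).exists_bound_of_continuousOn hf.continuousOn
  refine MemLp.of_bound hf.aestronglyMeasurable C ?_
  filter_upwards [ae_mem_halfAnnulus δ] with z hz
  exact hC z (by simpa using hz.2.1.le)

theorem continuous_frameDeriv {φ : ℂ → ℂ} (hφ : ContDiff ℝ ∞ φ) (v : ℂ) :
    Continuous (frameDeriv flatFactor v φ) := by
  simp only [funext (frameDeriv_flatFactor v φ)]
  exact (Complex.continuous_ofReal.comp continuous_norm).mul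
    ((hφ.continuous_fderiv (by simp)).clm_apply continuous_const)

end LogCoordinates

end SpectralDet

namespace SpectralDet

/-! ### Smooth functions that vanish on the Dirichlet part of the boundary -/

noncomputable section FormDomain

theorem tendsto_toLp_of_dominated {α : Type*} {m : MeasurableSpace α} {μ : Measure α}
    {f : ℕ → α → ℂ} {g : α → ℂ} {G : α → ℝ} (hf : ∀ k, MemLp (f k) 2 μ) (hg : MemLp g 2 μ)
    (hG : MemLp G 2 μ) (hb : ∀ k, ∀ᵐ z ∂μ, ‖f k z - g z‖ ≤ G z)
    (hlim : ∀ᵐ z ∂μ, Tendsto (fun k => f k z) atTop (𝓝 (g z))) :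
    Tendsto (fun k => (hf k).toLp (f k)) atTop (𝓝 (hg.toLp g)) := by
  rw [Lp.tendsto_Lp_iff_tendsto_eLpNorm'']
  have h2 : Tendsto (fun k => ∫⁻ z, ‖(f k - g) z‖ₑ ^ (2 : ℝ) ∂μ) atTop (𝓝 (∫⁻ _, 0 ∂μ)) := by
    refine tendsto_lintegral_of_dominated_convergence' (fun z => ‖G z‖ₑ ^ (2 : ℝ))
      (fun k => (((hf k).sub hg).aestronglyMeasurable.enorm).pow_const _) (fun k => ?_) ?_ ?_
    · filter_upwards [hb k] with z hz
      gcongr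
      refine enorm_le_iff_norm_le.2 ?_
      exact hz.trans (le_abs_self _)
    · have := (eLpNorm_lt_top_iff_lintegral_rpow_enorm_lt_top (by norm_num) (by norm_num)).1 hG.2
      simpa using this.ne
    · filter_upwards [hlim] with z hz
      have h3 : Tendsto (fun k => ‖(f k - g) z‖ₑ) atTop (𝓝 0) := by
        have := (hz.sub_const (g z)).enorm
        simpa using this
      have h4 := h3.ennrpow_const 2
      simpa using h4
  simp only [lintegral_zero] at h2
  have h5 := h2.ennrpow_const (1 / 2)
  rw [ENNReal.zero_rpow_of_pos (by norm_num)] at h5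
  refine h5.congr fun k => ?_
  rw [eLpNorm_eq_lintegral_rpow_enorm_toReal (by norm_num) (by norm_num)]
  simp

/-- Made for the truncation `u - ε ψ(u/ε)`, which vanishes where `|u| ≤ ε`, equals `u` where `|u| >
2ε`, and has gradient `(1 - ψ'(u/ε)) ∇u`, bounded by a multiple of `|∇u|` uniformly in `ε`. -/
theorem exists_truncation : ∃ ψ ψ' : ℝ → ℝ, ContDiff ℝ ∞ ψ ∧ (∀ t, HasDerivAt ψ (ψ' t) t) ∧
    (∃ C, ∀ t, |ψ t| ≤ C) ∧ (∃ C, ∀ t, |ψ' t| ≤ C) ∧ (∀ t, |t| ≤ 1 → ψ t = t) ∧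
    ∀ t, 2 < |t| → ψ t = 0 ∧ ψ' t = 0 := by
  let b : ContDiffBump (0 : ℝ) := ⟨1, 2, one_pos, one_lt_two⟩
  have hc : ContDiff ℝ ∞ (fun t => t * b t) := contDiff_id.mul b.contDiff
  have hs : HasCompactSupport (fun t => t * b t) := b.hasCompactSupport.mul_left
  have hout : ∀ t : ℝ, 2 < |t| → (fun t => t * b t) t = 0 := fun t ht => by
    have : b t = 0 := b.zero_of_le_dist (by simpa [Real.dist_eq] using ht.le)
    simp [this]
  refine ⟨fun t => t * b t, deriv fun t => t * b t, hc,
    fun t => (hc.differentiable (by simp) t).hasDerivAt, ?_, ?_, fun t ht => ?_, fun t ht => ?_⟩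
  · exact hs.exists_bound_of_continuous hc.continuous
  · exact hs.deriv.exists_bound_of_continuous (hc.continuous_deriv (by simp))
  · have : b t = 1 := b.one_of_mem_closedBall (by simpa [Real.dist_eq] using ht)
    simp [this]
  · refine ⟨hout t ht, ?_⟩
    have h : (fun t => t * b t) =ᶠ[𝓝 t] fun _ => 0 := by
      filter_upwards [(isOpen_lt continuous_const continuous_abs).mem_nhds ht] with s hs
      exact hout s hs
    rw [h.deriv_eq, deriv_const]

/-- The element of `L²` defined by a continuous function. -/
def contL2 {δ : ℝ} (h0 : 0 < δ) (f : ℂ → ℂ) (hf : Continuous f) : L2 (halfAnnulus δ) flatFactor :=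
  (memLp_annulusMeasure h0 hf).toLp f

theorem coeFn_contL2 {δ : ℝ} (h0 : 0 < δ) {f : ℂ → ℂ} (hf : Continuous f) :
    contL2 h0 f hf =ᵐ[annulusMeasure δ] f := MemLp.coeFn_toLp _

theorem contDiff_ofReal {u : ℂ → ℝ} (hu : ContDiff ℝ ∞ u) : ContDiff ℝ ∞ fun z => (u z : ℂ) :=
  Complex.ofRealCLM.contDiff.comp hu

/-- A smooth function together with its gradient, as an element of `L² × (L² × L²)`. -/
def smoothPair {δ : ℝ} (h0 : 0 < δ) (φ : ℂ → ℂ) (hφ : ContDiff ℝ ∞ φ) :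
    L2 (halfAnnulus δ) flatFactor × L2 (halfAnnulus δ) flatFactor × L2 (halfAnnulus δ) flatFactor :=
  (contL2 h0 φ hφ.continuous, contL2 h0 _ (continuous_frameDeriv hφ 1),
    contL2 h0 _ (continuous_frameDeriv hφ Complex.I))

theorem smoothPair_mem_smoothGradGraph {δ : ℝ} (h0 : 0 < δ) {φ : ℂ → ℂ} (hφ : ContDiff ℝ ∞ φ)
    {D : Set ℂ} (hD : Disjoint (tsupport φ) D) :
    smoothPair h0 φ hφ ∈ smoothGradGraph (halfAnnulus δ) flatFactor D :=
  ⟨φ, hφ, hD, coeFn_contL2 h0 hφ.continuous, coeFn_contL2 h0 (continuous_frameDeriv hφ 1),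
    coeFn_contL2 h0 (continuous_frameDeriv hφ Complex.I)⟩

/-- A smooth function that vanishes on `D`, and almost nowhere else, is in the form domain. -/
theorem smoothPair_mem_gradGraph {δ : ℝ} (h0 : 0 < δ) {u : ℂ → ℝ} (hu : ContDiff ℝ ∞ u)
    {D : Set ℂ} (hD : ∀ z ∈ D, u z = 0) (hne : ∀ᵐ z ∂(annulusMeasure δ), u z ≠ 0) :
    smoothPair h0 (fun z => (u z : ℂ)) (contDiff_ofReal hu) ∈
      gradGraph (halfAnnulus δ) flatFactor D := by
  obtain ⟨ψ, ψ', hψ, hψd, ⟨C, hC⟩, ⟨C', hC'⟩, hin, hout⟩ := exists_truncation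
  have := isFiniteMeasure_annulusMeasure h0
  have hk : ∀ k : ℕ, (0 : ℝ) < k + 1 := fun k => by positivity
  -- Truncation at height `ε = 1/(k + 1)`. The support lies in the closed set `|u| ≥ ε`, which
  -- misses `D`. Where `u ≠ 0`, hence almost everywhere, `φ k` and its gradient agree with those of
  -- `u` for large `k`, so dominated convergence applies.
  set φ : ℕ → ℂ → ℝ := fun k z => u z - (k + 1 : ℝ)⁻¹ * ψ ((k + 1) * u z) with hφdef
  have hφ : ∀ k, ContDiff ℝ ∞ (φ k) := fun k =>
    hu.sub (contDiff_const.mul (hψ.comp (contDiff_const.mul hu)))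
  have hsupp : ∀ k, Disjoint (tsupport fun z => (φ k z : ℂ)) D := fun k => by
    have hsub : tsupport (fun z => (φ k z : ℂ)) ⊆ {z | 1 ≤ |(k + 1) * u z|} := by
      refine closure_minimal (fun z hz => ?_)
        (isClosed_le continuous_const (continuous_const.mul hu.continuous).abs)
      by_contra h
      refine hz ?_
      simp only [mem_ofPred_eq, not_le] at h
      simp only [φ, hin _ h.le]
      rw [inv_mul_cancel_left₀ (hk k).ne']
      simp
    refine Disjoint.mono_left hsub (disjoint_left.2 fun z hz hzD => ?_)
    simp only [mem_ofPred_eq, hD z hzD] at hz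
    norm_num at hz
  have hfd : ∀ k v z, frameDeriv flatFactor v (fun z => (φ k z : ℂ)) z =
      frameDeriv flatFactor v (fun z => (u z : ℂ)) z -
        (ψ' ((k + 1) * u z) : ℂ) * frameDeriv flatFactor v (fun z => (u z : ℂ)) z := by
    intro k v z
    have h1 : HasFDerivAt u (fderiv ℝ u z) z := (hu.differentiable (by simp) z).hasFDerivAt
    have h2 := ((hψd ((k + 1) * u z)).comp_hasFDerivAt z (h1.const_mul (k + 1 : ℝ))).const_mul
      (k + 1 : ℝ)⁻¹
    have h3 := Complex.ofRealCLM.hasFDerivAt.comp z (h1.sub h2)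
    have h4 := Complex.ofRealCLM.hasFDerivAt.comp z h1
    have e3 : fderiv ℝ (fun z => (φ k z : ℂ)) z = _ := h3.fderiv
    have e4 : fderiv ℝ (fun z => (u z : ℂ)) z = _ := h4.fderiv
    rw [frameDeriv_flatFactor, frameDeriv_flatFactor, e3, e4]
    have hk' : (k + 1 : ℂ) ≠ 0 := by exact_mod_cast (hk k).ne'
    simp
    field_simp
  have hev : ∀ z, u z ≠ 0 → ∀ᶠ k : ℕ in atTop, 2 < |((k : ℝ) + 1) * u z| := fun z hz => by
    have h1 : Tendsto (fun k : ℕ => ((k : ℝ) + 1) * |u z|) atTop atTop :=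
      (tendsto_natCast_atTop_atTop.atTop_add tendsto_const_nhds).atTop_mul_const (abs_pos.2 hz)
    filter_upwards [h1.eventually_gt_atTop 2] with k hk'
    rwa [abs_mul, abs_of_pos (hk k)]
  have hgrad : ∀ v, Tendsto (fun k => contL2 h0 _ (continuous_frameDeriv (contDiff_ofReal (hφ k)) v))
      atTop (𝓝 (contL2 h0 _ (continuous_frameDeriv (contDiff_ofReal hu) v))) := fun v => by
    refine tendsto_toLp_of_dominated
      (fun k => memLp_annulusMeasure h0 (continuous_frameDeriv (contDiff_ofReal (hφ k)) v))
      (memLp_annulusMeasure h0 (continuous_frameDeriv (contDiff_ofReal hu) v)) (G := fun z => C' * ‖frameDeriv flatFactor v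
        (fun z => (u z : ℂ)) z‖) ?_ (fun k => Eventually.of_forall fun z => ?_) ?_
    · exact (memLp_annulusMeasure h0 (continuous_frameDeriv (contDiff_ofReal hu) v)).norm.const_mul C'
    · rw [hfd, sub_sub_cancel_left, norm_neg, norm_mul, Complex.norm_real]
      gcongr
      exact hC' _
    · filter_upwards [hne] with z hz
      refine tendsto_const_nhds.congr' ?_
      filter_upwards [hev z hz] with k hk'
      simp [hfd, (hout _ hk').2]
  refine mem_closure_of_tendsto (b := atTop)
    (f := fun k => smoothPair h0 _ (contDiff_ofReal (hφ k))) ?_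
    (Eventually.of_forall fun k => smoothPair_mem_smoothGradGraph h0 _ (hsupp k))
  refine Tendsto.prodMk_nhds ?_ ((hgrad 1).prodMk_nhds (hgrad Complex.I))
  refine tendsto_toLp_of_dominated
      (fun k => memLp_annulusMeasure h0 (contDiff_ofReal (hφ k)).continuous)
      (memLp_annulusMeasure h0 (contDiff_ofReal hu).continuous) (G := fun _ => C) (memLp_const C)
      (fun k => Eventually.of_forall fun z => ?_) ?_
  · simp only [φ]
    rw [← Complex.ofReal_sub, sub_sub_cancel_left, Complex.norm_real, norm_neg, norm_mul,
      Real.norm_of_nonneg (by positivity)]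
    refine (mul_le_of_le_one_left (norm_nonneg _) (inv_le_one_of_one_le₀ (by simp))).trans (hC _)
  · filter_upwards [hne] with z hz
    refine tendsto_const_nhds.congr' ?_
    filter_upwards [hev z hz] with k hk'
    simp [φ, (hout _ hk').1]

end FormDomain

end SpectralDet

namespace SpectralDet

/-! ### Green's formula for functions that separate in logarithmic coordinates -/

noncomputable section Green

/-- The derivative of `v` along the radial vector field `∂_x` of logarithmic coordinates. -/
def radialDeriv (v : ℂ → ℂ) (p : ℝ × ℝ) : ℂ := fderiv ℝ v (polarExp p) (polarExp p)

/-- The derivative of `v` along the angular vector field `∂_θ` of logarithmic coordinates. -/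
def angularDeriv (v : ℂ → ℂ) (p : ℝ × ℝ) : ℂ :=
  fderiv ℝ v (polarExp p) (polarExp p * Complex.I)

variable {v : ℂ → ℂ}

theorem continuous_radialDeriv (hv : ContDiff ℝ ∞ v) : Continuous (radialDeriv v) :=
  ((hv.continuous_fderiv (by simp)).comp continuous_polarExp).clm_apply continuous_polarExp

theorem continuous_angularDeriv (hv : ContDiff ℝ ∞ v) : Continuous (angularDeriv v) :=
  ((hv.continuous_fderiv (by simp)).comp continuous_polarExp).clm_apply
    (continuous_polarExp.mul continuous_const)

theorem hasDerivAt_polarExp_fst (x θ : ℝ) :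
    HasDerivAt (fun x : ℝ => polarExp (x, θ)) (polarExp (x, θ)) x := by
  have h := ((Complex.ofRealCLM.hasDerivAt (x := x)).add_const ((θ : ℂ) * Complex.I)).cexp
  simpa [polarExp] using h

theorem hasDerivAt_polarExp_snd (x θ : ℝ) :
    HasDerivAt (fun θ : ℝ => polarExp (x, θ)) (polarExp (x, θ) * Complex.I) θ := by
  have h := (((Complex.ofRealCLM.hasDerivAt (x := θ)).mul_const Complex.I).const_add (x : ℂ)).cexp
  simpa [polarExp] using h

theorem hasDerivAt_comp_polarExp_fst (hv : ContDiff ℝ ∞ v) (x θ : ℝ) :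
    HasDerivAt (fun x : ℝ => v (polarExp (x, θ))) (radialDeriv v (x, θ)) x :=
  ((hv.differentiable (by simp) _).hasFDerivAt).comp_hasDerivAt x (hasDerivAt_polarExp_fst x θ)

theorem hasDerivAt_comp_polarExp_snd (hv : ContDiff ℝ ∞ v) (x θ : ℝ) :
    HasDerivAt (fun θ : ℝ => v (polarExp (x, θ))) (angularDeriv v (x, θ)) θ :=
  ((hv.differentiable (by simp) _).hasFDerivAt).comp_hasDerivAt θ (hasDerivAt_polarExp_snd x θ)

/-- The fields `z` and `iz` are obtained from the orthonormal frame `|z| ∂_x`, `|z| ∂_y` by the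
rotation of angle `arg z`, which preserves the inner product of gradients. -/
theorem gradient_inner_polarExp (v u : ℂ → ℂ) (p : ℝ × ℝ) :
    starRingEnd ℂ (frameDeriv flatFactor 1 v (polarExp p)) *
        frameDeriv flatFactor 1 u (polarExp p) +
      starRingEnd ℂ (frameDeriv flatFactor Complex.I v (polarExp p)) *
        frameDeriv flatFactor Complex.I u (polarExp p) =
    starRingEnd ℂ (radialDeriv v p) * radialDeriv u p +
      starRingEnd ℂ (angularDeriv v p) * angularDeriv u p := by
  simp only [frameDeriv_flatFactor, radialDeriv, angularDeriv]
  generalize polarExp p = z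
  have hz : ∀ A : ℂ →L[ℝ] ℂ, A z = z.re * A 1 + z.im * A Complex.I := fun A => by
    conv_lhs => rw [← Complex.re_add_im z]
    have e : (z.re : ℂ) + z.im * Complex.I = z.re • (1 : ℂ) + z.im • Complex.I := by simp
    rw [e, map_add, map_smul, map_smul]
    simp
  have hz' : ∀ A : ℂ →L[ℝ] ℂ, A (z * Complex.I) = -z.im * A 1 + z.re * A Complex.I := fun A => by
    have e : z * Complex.I = (-z.im) • (1 : ℂ) + z.re • Complex.I := by
      apply Complex.ext <;> simp
    rw [e, map_add, map_smul, map_smul]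
    simp
  have hn : (‖z‖ : ℂ) * ‖z‖ = z.re * z.re + z.im * z.im := by
    have := Complex.normSq_eq_norm_sq z
    rw [Complex.normSq_apply] at this
    exact_mod_cast (this.trans (sq _)).symm
  simp only [hz (fderiv ℝ v z), hz (fderiv ℝ u z), hz' (fderiv ℝ v z), hz' (fderiv ℝ u z),
    map_add, map_mul, map_neg, Complex.conj_ofReal]
  linear_combination ((starRingEnd ℂ) (fderiv ℝ v z 1) * fderiv ℝ u z 1 +
    (starRingEnd ℂ) (fderiv ℝ v z Complex.I) * fderiv ℝ u z Complex.I) * hn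

/-- `f'' = -α f`. -/
structure IsMode (f f' : ℝ → ℝ) (α : ℝ) : Prop where
  hasDerivAt : ∀ x, HasDerivAt f (f' x) x
  hasDerivAt_deriv : ∀ x, HasDerivAt f' (-α * f x) x

namespace IsMode

variable {f f' : ℝ → ℝ} {α : ℝ}

theorem continuous (h : IsMode f f' α) : Continuous f :=
  continuous_iff_continuousAt.2 fun x => (h.hasDerivAt x).continuousAt

theorem continuous_deriv (h : IsMode f f' α) : Continuous f' :=
  continuous_iff_continuousAt.2 fun x => (h.hasDerivAt_deriv x).continuousAt

theorem integral_deriv_mul (h : IsMode f f' α) {W W' : ℝ → ℂ} (hW : ∀ x, HasDerivAt W (W' x) x)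
    (hW' : Continuous W') {a b : ℝ} (ha : W a * f' a = 0) (hb : W b * f' b = 0) :
    ∫ x in a..b, W' x * f' x = α * ∫ x in a..b, W x * f x := by
  have hWc : Continuous W := continuous_iff_continuousAt.2 fun x => (hW x).continuousAt
  have hf : Continuous fun x => (f x : ℂ) := Complex.continuous_ofReal.comp h.continuous
  have h1 := intervalIntegral.integral_mul_deriv_eq_deriv_mul (a := a) (b := b)
    (u := W) (v := fun x => (f' x : ℂ)) (u' := W') (v' := fun x => ((-α * f x : ℝ) : ℂ))
    (fun x _ => hW x) (fun x _ => (h.hasDerivAt_deriv x).ofReal_comp)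
    (hW'.intervalIntegrable _ _) (Continuous.intervalIntegrable
      (Complex.continuous_ofReal.comp (continuous_const.mul h.continuous)) _ _)
  rw [ha, hb, sub_zero, zero_sub, ← neg_eq_iff_eq_neg] at h1
  rw [← h1, ← intervalIntegral.integral_neg, ← intervalIntegral.integral_const_mul]
  refine intervalIntegral.integral_congr fun x _ => ?_
  push_cast
  ring

/-- Integrating `∫ f' g'` by parts in the two possible ways gives `β ∫ f g = α ∫ f g`. -/
theorem integral_mul_eq_zero {g g' : ℝ → ℝ} {β : ℝ} (h : IsMode f f' α) (hg : IsMode g g' β)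
    (hne : α ≠ β) {a b : ℝ} (ha : f a * g' a = 0) (hb : f b * g' b = 0) (ha' : g a * f' a = 0)
    (hb' : g b * f' b = 0) : ∫ x in a..b, (f x : ℂ) * g x = 0 := by
  have e1 := hg.integral_deriv_mul (fun x => (h.hasDerivAt x).ofReal_comp)
    (Complex.continuous_ofReal.comp h.continuous_deriv) (a := a) (b := b)
    (by exact_mod_cast ha) (by exact_mod_cast hb)
  have e2 := h.integral_deriv_mul (fun x => (hg.hasDerivAt x).ofReal_comp)
    (Complex.continuous_ofReal.comp hg.continuous_deriv) (a := a) (b := b)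
    (by exact_mod_cast ha') (by exact_mod_cast hb')
  have e3 : ∀ F G : ℝ → ℝ, ∫ x in a..b, (F x : ℂ) * G x = ∫ x in a..b, (G x : ℂ) * F x :=
    fun F G => intervalIntegral.integral_congr fun x _ => mul_comm _ _
  rw [e3 g' f', e1, e3 g f, ← sub_eq_zero, ← sub_mul] at e2
  refine (mul_eq_zero.1 e2).resolve_left ?_
  exact_mod_cast sub_ne_zero.2 hne.symm

end IsMode

theorem ofReal_radialDeriv {δ : ℝ} {u : ℂ → ℝ} (hu : ContDiff ℝ ∞ fun z => (u z : ℂ))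
    {f h f' : ℝ → ℝ} (hf : ∀ x, HasDerivAt f (f' x) x)
    (huf : ∀ p ∈ logRect δ, u (polarExp p) = f p.1 * h p.2) {p : ℝ × ℝ} (hp : p ∈ logRect δ) :
    radialDeriv (fun z => (u z : ℂ)) p = f' p.1 * h p.2 := by
  refine (hasDerivAt_comp_polarExp_fst hu p.1 p.2).unique ?_
  refine (((hf p.1).ofReal_comp).mul_const (h p.2 : ℂ)).congr_of_eventuallyEq ?_
  filter_upwards [Ioo_mem_nhds hp.1.1 hp.1.2] with x hx
  rw [huf (x, p.2) ⟨hx, hp.2⟩]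
  push_cast
  rfl

theorem ofReal_angularDeriv {δ : ℝ} {u : ℂ → ℝ} (hu : ContDiff ℝ ∞ fun z => (u z : ℂ))
    {f h h' : ℝ → ℝ} (hh : ∀ x, HasDerivAt h (h' x) x)
    (huf : ∀ p ∈ logRect δ, u (polarExp p) = f p.1 * h p.2) {p : ℝ × ℝ} (hp : p ∈ logRect δ) :
    angularDeriv (fun z => (u z : ℂ)) p = f p.1 * h' p.2 := by
  refine (hasDerivAt_comp_polarExp_snd hu p.1 p.2).unique ?_
  refine (((hh p.2).ofReal_comp).const_mul (f p.1 : ℂ)).congr_of_eventuallyEq ?_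
  filter_upwards [Ioo_mem_nhds hp.2.1 hp.2.2] with x hx
  rw [huf (p.1, x) ⟨hp.1, hx⟩]
  push_cast
  rfl

/-- Green's formula for a separated function `u = f(x) h(θ)`. -/
theorem green_separated {δ : ℝ} (h0 : 0 < δ) (h1 : δ < 1) {u : ℂ → ℝ}
    (hu : ContDiff ℝ ∞ fun z => (u z : ℂ)) {f f' h h' : ℝ → ℝ} {α β : ℝ} (hf : IsMode f f' α)
    (hh : IsMode h h' β) (huf : ∀ p ∈ logRect δ, u (polarExp p) = f p.1 * h p.2)
    (hv : ContDiff ℝ ∞ v) (hv1 : ∀ θ ∈ Icc 0 Real.pi, v (polarExp (Real.log δ, θ)) = 0)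
    (hv2 : ∀ θ ∈ Icc 0 Real.pi, v (polarExp (0, θ)) = 0)
    (hv3 : ∀ x ∈ Icc (Real.log δ) 0, v (polarExp (x, 0)) * h' 0 = 0)
    (hv4 : ∀ x ∈ Icc (Real.log δ) 0, v (polarExp (x, Real.pi)) * h' Real.pi = 0) :
    ∫ z, (starRingEnd ℂ (frameDeriv flatFactor 1 v z) *
          frameDeriv flatFactor 1 (fun z => (u z : ℂ)) z +
        starRingEnd ℂ (frameDeriv flatFactor Complex.I v z) *
          frameDeriv flatFactor Complex.I (fun z => (u z : ℂ)) z) ∂(annulusMeasure δ) =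
      ((α + β : ℝ) : ℂ) * ∫ z, starRingEnd ℂ (v z) * u z ∂(annulusMeasure δ) := by
  have hconj := Complex.continuous_conj
  have hfc := Complex.continuous_ofReal.comp hf.continuous
  have hfc' := Complex.continuous_ofReal.comp hf.continuous_deriv
  have hhc := Complex.continuous_ofReal.comp hh.continuous
  have hhc' := Complex.continuous_ofReal.comp hh.continuous_deriv
  have hm : MeasurableSet (logRect δ) := measurableSet_Ioo.prod measurableSet_Ioo
  have c1 : Continuous fun p : ℝ × ℝ => starRingEnd ℂ (radialDeriv v p) * (f' p.1 * h p.2) :=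
    (hconj.comp (continuous_radialDeriv hv)).mul
      ((hfc'.comp continuous_fst).mul (hhc.comp continuous_snd))
  have c2 : Continuous fun p : ℝ × ℝ => starRingEnd ℂ (angularDeriv v p) * (f p.1 * h' p.2) :=
    (hconj.comp (continuous_angularDeriv hv)).mul
      ((hfc.comp continuous_fst).mul (hhc'.comp continuous_snd))
  have c3 : Continuous fun p : ℝ × ℝ => starRingEnd ℂ (v (polarExp p)) * (f p.1 * h p.2) :=
    (hconj.comp (hv.continuous.comp continuous_polarExp)).mul
      ((hfc.comp continuous_fst).mul (hhc.comp continuous_snd))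
  have cfd := fun w : ℂ => continuous_frameDeriv hv w
  have cfu := fun w : ℂ => continuous_frameDeriv hu w
  have c4 : Continuous fun z => starRingEnd ℂ (frameDeriv flatFactor 1 v z) *
        frameDeriv flatFactor 1 (fun z => (u z : ℂ)) z +
      starRingEnd ℂ (frameDeriv flatFactor Complex.I v z) *
        frameDeriv flatFactor Complex.I (fun z => (u z : ℂ)) z :=
    ((hconj.comp (cfd 1)).mul (cfu 1)).add ((hconj.comp (cfd _)).mul (cfu _))
  have c5 : Continuous fun z => starRingEnd ℂ (v z) * u z :=
    (hconj.comp hv.continuous).mul hu.continuous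
  rw [integral_annulusMeasure h0 c4.aestronglyMeasurable,
    integral_annulusMeasure h0 c5.aestronglyMeasurable]
  have e1 : ∫ p in logRect δ, starRingEnd ℂ (v (polarExp p)) * u (polarExp p) =
      ∫ p in logRect δ, starRingEnd ℂ (v (polarExp p)) * (f p.1 * h p.2) :=
    setIntegral_congr_fun hm fun p hp => by
      simp only [huf p hp, Complex.ofReal_mul]
  have e2 : ∫ p in logRect δ, starRingEnd ℂ (radialDeriv v p) * (f' p.1 * h p.2) =
      α * ∫ p in logRect δ, starRingEnd ℂ (v (polarExp p)) * (f p.1 * h p.2) := by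
    rw [integral_logRect_swap h0 h1 c1, integral_logRect_swap h0 h1 c3,
      ← intervalIntegral.integral_const_mul]
    refine intervalIntegral.integral_congr fun θ hθ => ?_
    rw [uIcc_of_le Real.pi_pos.le] at hθ
    have := hf.integral_deriv_mul (fun x => ((hasDerivAt_comp_polarExp_fst hv x θ).star))
      (hconj.comp ((continuous_radialDeriv hv).comp (Continuous.prodMk_left θ)))
      (a := Real.log δ) (b := 0) (by simp [hv1 θ hθ]) (by simp [hv2 θ hθ])
    simp only [mul_comm _ (h θ : ℂ), mul_left_comm _ (h θ : ℂ),
      intervalIntegral.integral_const_mul]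
    exact congrArg (fun t => (h θ : ℂ) * t) this
  have e3 : ∫ p in logRect δ, starRingEnd ℂ (angularDeriv v p) * (f p.1 * h' p.2) =
      β * ∫ p in logRect δ, starRingEnd ℂ (v (polarExp p)) * (f p.1 * h p.2) := by
    rw [integral_logRect h0 h1 c2, integral_logRect h0 h1 c3,
      ← intervalIntegral.integral_const_mul]
    refine intervalIntegral.integral_congr fun x hx => ?_
    rw [uIcc_of_le (Real.log_neg h0 h1).le] at hx
    -- Only the product of `v` and `h'` has to vanish at the ends of the angular interval, which
    -- covers Dirichlet (`v = 0`) and Neumann (`h' = 0`) alike.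
    have hz : ∀ a b : ℂ, a * b = 0 → star a * b = 0 := fun a b hab => by
      rcases mul_eq_zero.1 hab with h | h <;> simp [h]
    have := hh.integral_deriv_mul (fun θ => ((hasDerivAt_comp_polarExp_snd hv x θ).star))
      (hconj.comp ((continuous_angularDeriv hv).comp (Continuous.prodMk_right x)))
      (a := 0) (b := Real.pi) (hz _ _ (hv3 x hx)) (hz _ _ (hv4 x hx))
    simp only [mul_left_comm _ (f x : ℂ), intervalIntegral.integral_const_mul]
    exact congrArg (fun t => (f x : ℂ) * t) this
  rw [e1, Complex.ofReal_add, add_mul, ← e2, ← e3,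
    ← integral_add (integrableOn_logRect δ c1) (integrableOn_logRect δ c2)]
  refine setIntegral_congr_fun hm fun p hp => ?_
  simp only [gradient_inner_polarExp, ofReal_radialDeriv hu hf.hasDerivAt huf hp,
    ofReal_angularDeriv hu hh.hasDerivAt huf hp]

end Green

end SpectralDet

namespace SpectralDet

/-! ### Completeness of the trigonometric systems on a rectangle -/

noncomputable section Completeness

/-- The closed rectangle of logarithmic coordinates. -/
abbrev closedRect (δ : ℝ) : Set (ℝ × ℝ) := Icc (Real.log δ) 0 ×ˢ Icc 0 Real.pi

/-- The frequency `π / |log δ|`. -/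
def radialFreq (δ : ℝ) : ℝ := Real.pi / -Real.log δ

/-- The function `cos (j a x) cos (k θ)` on the closed rectangle. -/
def cosCos (δ : ℝ) (j k : ℤ) : C(closedRect δ, ℝ) :=
  ⟨fun p => Real.cos (j * (radialFreq δ * p.1.1)) * Real.cos (k * p.1.2), by fun_prop⟩

/-- Product-to-sum formula: the span of the `cosCos δ j k` is stable under multiplication by the
generators. Integer rather than natural indices avoid a special case at `j = 0`. -/
theorem cosCos_one_zero_mul (δ : ℝ) (j k : ℤ) :
    cosCos δ 1 0 * cosCos δ j k =
      (1 / 2 : ℝ) • cosCos δ (j + 1) k + (1 / 2 : ℝ) • cosCos δ (j - 1) k := by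
  ext p
  simp only [cosCos, ContinuousMap.mul_apply, ContinuousMap.add_apply, ContinuousMap.smul_apply,
    ContinuousMap.coe_mk, smul_eq_mul]
  push_cast
  rw [add_mul (j : ℝ), sub_mul (j : ℝ), Real.cos_add, Real.cos_sub, zero_mul, Real.cos_zero]
  ring

theorem cosCos_zero_one_mul (δ : ℝ) (j k : ℤ) :
    cosCos δ 0 1 * cosCos δ j k =
      (1 / 2 : ℝ) • cosCos δ j (k + 1) + (1 / 2 : ℝ) • cosCos δ j (k - 1) := by
  ext p
  simp only [cosCos, ContinuousMap.mul_apply, ContinuousMap.add_apply, ContinuousMap.smul_apply,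
    ContinuousMap.coe_mk, smul_eq_mul]
  push_cast
  rw [add_mul (k : ℝ), sub_mul (k : ℝ), Real.cos_add, Real.cos_sub, zero_mul, Real.cos_zero]
  ring

/-- Cosine is injective on `[0, π]`, and `x ↦ -(radialFreq δ * x)` maps `[log δ, 0]` into that
interval. -/
theorem cosCos_separatesPoints {δ : ℝ} (h0 : 0 < δ) (h1 : δ < 1) :
    (Algebra.adjoin ℝ {cosCos δ 1 0, cosCos δ 0 1}).SeparatesPoints := by
  have hlog := Real.log_neg h0 h1
  rintro ⟨⟨x, θ⟩, ⟨hx, hx'⟩, hθ⟩ ⟨⟨y, η⟩, ⟨hy, hy'⟩, hη⟩ hne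
  by_contra hcon
  have h : ∀ g ∈ ({cosCos δ 1 0, cosCos δ 0 1} : Set C(closedRect δ, ℝ)),
      g ⟨(x, θ), ⟨hx, hx'⟩, hθ⟩ = g ⟨(y, η), ⟨hy, hy'⟩, hη⟩ := fun g hg => by
    by_contra hg'
    exact hcon ⟨g, ⟨g, Algebra.subset_adjoin hg, rfl⟩, hg'⟩
  have e1 := h _ (mem_insert _ _)
  have e2 := h _ (mem_insert_of_mem _ rfl)
  simp only [cosCos, ContinuousMap.coe_mk, Int.cast_one, Int.cast_zero, one_mul, zero_mul,
    Real.cos_zero, mul_one] at e1 e2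
  have hmem : ∀ t, Real.log δ ≤ t → t ≤ 0 → -(radialFreq δ * t) ∈ Icc 0 Real.pi := fun t ht ht' => by
    have e : -(radialFreq δ * t) = Real.pi * (t / Real.log δ) := by
      rw [radialFreq]; field_simp
    rw [e]
    exact ⟨mul_nonneg Real.pi_pos.le (div_nonneg_of_nonpos ht' hlog.le),
      mul_le_of_le_one_right Real.pi_pos.le ((div_le_one_of_neg hlog).2 ht)⟩
  rw [← Real.cos_neg, ← Real.cos_neg (radialFreq δ * y)] at e1
  have e3 := Real.injOn_cos (hmem x hx hx') (hmem y hy hy') e1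
  have e4 := Real.injOn_cos hθ hη e2
  have e5 : radialFreq δ ≠ 0 := div_ne_zero Real.pi_ne_zero (neg_ne_zero.2 hlog.ne)
  have e6 : x = y := mul_left_cancel₀ e5 (neg_injective e3)
  subst e6 e4
  exact hne rfl

/-- As `F` is integrable, `g ↦ ∫ F g` is continuous for the sup norm on the closed rectangle. It
vanishes on the algebra generated by the two basic cosines, which is dense by Stone–Weierstrass, so
it vanishes on all continuous functions and `F = 0` almost everywhere. -/
theorem ae_eq_zero_of_cos_moments {δ : ℝ} (h0 : 0 < δ) (h1 : δ < 1) {F : ℝ × ℝ → ℂ}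
    (hF : IntegrableOn F (logRect δ))
    (hmom : ∀ j k : ℤ, ∫ p in logRect δ,
      F p * ((Real.cos (j * (radialFreq δ * p.1)) * Real.cos (k * p.2) : ℝ) : ℂ) = 0) :
    ∀ᵐ p ∂(volume.restrict (logRect δ)), F p = 0 := by
  have hK : IsCompact (closedRect δ) := isCompact_Icc.prod isCompact_Icc
  have : CompactSpace (closedRect δ) := isCompact_iff_compactSpace.1 hK
  have hKm := hK.measurableSet
  have hsub : logRect δ ⊆ closedRect δ := prod_mono Ioo_subset_Icc_self Ioo_subset_Icc_self
  set ν : Measure (closedRect δ) := Measure.comap Subtype.val (volume.restrict (logRect δ)) with hν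
  have hres : (volume.restrict (logRect δ)).restrict (closedRect δ) =
      volume.restrict (logRect δ) := by
    rw [Measure.restrict_restrict hKm, inter_eq_self_of_subset_right hsub]
  have hint : ∀ g : ℝ × ℝ → ℂ, ∫ x, g x ∂ν = ∫ p in logRect δ, g p := fun g => by
    rw [hν, integral_subtype_comap hKm, hres]
  have hFν : Integrable (fun x : closedRect δ => F x) ν := by
    have h := map_comap_subtype_coe hKm (volume.restrict (logRect δ))
    rw [hres] at h
    exact (MeasurableEmbedding.subtype_coe hKm).integrable_map_iff.1 (h ▸ hF)
  have hFg : ∀ g : C(closedRect δ, ℝ), Integrable (fun x : closedRect δ => F x * (g x : ℂ)) ν := fun g =>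
    hFν.mul_bdd (c := ‖g‖) (Complex.continuous_ofReal.comp g.continuous).aestronglyMeasurable
      (Eventually.of_forall fun x => by
        rw [Complex.norm_real]
        exact g.norm_coe_le_norm x)
  let Λ₀ : C(closedRect δ, ℝ) →ₗ[ℝ] ℂ :=
    { toFun := fun g => ∫ x : closedRect δ, F x * (g x : ℂ) ∂ν
      map_add' := fun g k => by
        rw [← integral_add (hFg g) (hFg k)]
        simp only [ContinuousMap.add_apply, Complex.ofReal_add, mul_add]
      map_smul' := fun r g => by
        rw [RingHom.id_apply, ← integral_smul]
        simp only [ContinuousMap.smul_apply, smul_eq_mul, Complex.ofReal_mul, Complex.real_smul]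
        exact integral_congr_ae (Eventually.of_forall fun x => mul_left_comm _ _ _) }
  let Λ : C(closedRect δ, ℝ) →L[ℝ] ℂ := Λ₀.mkContinuous (∫ x : closedRect δ, ‖F x‖ ∂ν) fun g => by
    rw [← integral_mul_const]
    refine norm_integral_le_of_norm_le (hFν.norm.mul_const _) (Eventually.of_forall fun x => ?_)
    rw [norm_mul, Complex.norm_real]
    gcongr
    exact g.norm_coe_le_norm x
  have hΛcos : ∀ j k, Λ (cosCos δ j k) = 0 := fun j k => (hint fun p => F p *
    ((Real.cos (j * (radialFreq δ * p.1)) * Real.cos (k * p.2) : ℝ) : ℂ)).trans (hmom j k)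
  -- The auxiliary factor `e` strengthens the induction: multiplication by `g` preserves the
  -- property that all cosine moments vanish, so products are handled by composition.
  have hstep : ∀ g ∈ Algebra.adjoin ℝ {cosCos δ 1 0, cosCos δ 0 1}, ∀ e,
      (∀ j k, Λ (e * cosCos δ j k) = 0) → ∀ j k, Λ ((g * e) * cosCos δ j k) = 0 := by
    intro g hg
    induction hg using Algebra.adjoin_induction with
    | mem g hg =>
      intro e he j k
      rw [mul_comm g, mul_assoc]
      rcases hg with rfl | rfl
      · rw [cosCos_one_zero_mul, mul_add, mul_smul_comm, mul_smul_comm, map_add, map_smul,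
          map_smul, he, he, smul_zero, add_zero]
      · rw [cosCos_zero_one_mul, mul_add, mul_smul_comm, mul_smul_comm, map_add, map_smul,
          map_smul, he, he, smul_zero, add_zero]
    | algebraMap r =>
      intro e he j k
      rw [← Algebra.smul_def, smul_mul_assoc, map_smul, he, smul_zero]
    | add g g' _ _ hg hg' =>
      intro e he j k
      rw [add_mul, add_mul, map_add, hg e he, hg' e he, add_zero]
    | mul g g' _ _ hg hg' =>
      intro e he
      rw [mul_assoc]
      exact hg _ (hg' e he)
  have hzero : ∀ g : C(closedRect δ, ℝ), Λ g = 0 := by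
    intro g
    have hdense := ContinuousMap.subalgebra_topologicalClosure_eq_top_of_separatesPoints _
      (cosCos_separatesPoints h0 h1)
    have hg : g ∈ (Algebra.adjoin ℝ {cosCos δ 1 0, cosCos δ 0 1}).topologicalClosure := by
      rw [hdense]; trivial
    refine closure_minimal (t := {g | Λ g = 0}) (fun g hg => ?_)
      (isClosed_eq Λ.continuous continuous_const) hg
    have h := hstep g hg 1 (fun j k => by rw [one_mul]; exact hΛcos j k) 0 0
    have e : cosCos δ 0 0 = 1 := by ext; simp [cosCos]
    rwa [e, mul_one, mul_one] at h
  refine ae_eq_zero_of_integral_contDiff_smul_eq_zero (Integrable.locallyIntegrable hF)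
    fun g hg _ => ?_
  rw [← hzero ⟨fun x => g x, hg.continuous.comp continuous_subtype_val⟩]
  refine Eq.trans ?_ (hint fun p => F p * (g p : ℂ)).symm
  simp only [Complex.real_smul, mul_comm]

end Completeness

end SpectralDet

namespace SpectralDet

/-! ### The eigenbasis of separated modes -/

noncomputable section Eigenbasis

/-- The zeros of a nonzero analytic function are isolated, hence a null set. -/
theorem ae_ne_zero_of_analytic {f : ℝ → ℝ} (hf : AnalyticOnNhd ℝ f univ) {x : ℝ} (hx : f x ≠ 0) :
    ∀ᵐ t, f t ≠ 0 := by
  have h := hf.preimage_zero_mem_codiscrete hx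
  have h2 := ae_restrict_le_codiscreteWithin (μ := (volume : Measure ℝ)) MeasurableSet.univ h
  rwa [Measure.restrict_univ] at h2

theorem ae_logRect_mul_ne_zero (δ : ℝ) {f h : ℝ → ℝ} (hf : ∀ᵐ t, f t ≠ 0) (hh : ∀ᵐ t, h t ≠ 0) :
    ∀ᵐ p ∂(volume.restrict (logRect δ)), f p.1 * h p.2 ≠ 0 := by
  refine ae_restrict_of_ae ?_
  rw [Measure.volume_eq_prod]
  filter_upwards [Measure.quasiMeasurePreserving_fst.ae hf,
    Measure.quasiMeasurePreserving_snd.ae hh] with p h1 h2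
  exact mul_ne_zero h1 h2

theorem annulusMeasure_ne_zero {δ : ℝ} (h0 : 0 < δ) (h1 : δ < 1) : annulusMeasure δ ≠ 0 := by
  intro h
  have h2 := (measurePreserving_polarExp h0).measure_preimage nullMeasurableSet_univ
  rw [h, preimage_univ, Measure.restrict_apply_univ, logRect, Measure.volume_eq_prod,
    Measure.prod_prod, Real.volume_Ioo, Real.volume_Ioo] at h2
  have := Real.log_neg h0 h1
  have := Real.pi_pos
  simp at h2
  rcases h2 with h2 | h2 <;> linarith

theorem inner_contL2 {δ : ℝ} (h0 : 0 < δ) {f g : ℂ → ℂ} (hf : Continuous f) (hg : Continuous g) :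
    inner ℂ (contL2 h0 f hf) (contL2 h0 g hg) =
      ∫ z, starRingEnd ℂ (f z) * g z ∂(annulusMeasure δ) := by
  rw [L2.inner_def]
  refine integral_congr_ae ?_
  filter_upwards [coeFn_contL2 h0 hf, coeFn_contL2 h0 hg] with z h1 h2
  rw [h1, h2, RCLike.inner_apply, mul_comm]

theorem integrable_annulusMeasure {δ : ℝ} (h0 : 0 < δ) {f : ℂ → ℂ} (hf : Continuous f) :
    Integrable f (annulusMeasure δ) := by
  have := isFiniteMeasure_annulusMeasure h0
  exact (memLp_annulusMeasure h0 hf).integrable (by norm_num)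

theorem exists_smoothPair_eq {δ : ℝ} (h0 : 0 < δ) {D : Set ℂ}
    {p : L2 (halfAnnulus δ) flatFactor × L2 (halfAnnulus δ) flatFactor ×
      L2 (halfAnnulus δ) flatFactor} (hp : p ∈ smoothGradGraph (halfAnnulus δ) flatFactor D) :
    ∃ (φ : ℂ → ℂ) (hφ : ContDiff ℝ ∞ φ), (∀ z ∈ D, φ z = 0) ∧ p = smoothPair h0 φ hφ := by
  obtain ⟨φ, hφ, hD, h1, h2, h3⟩ := hp
  refine ⟨φ, hφ, fun z hz => image_eq_zero_of_notMem_tsupport fun h => disjoint_left.1 hD h hz, ?_⟩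
  exact Prod.ext (Lp.ext (h1.trans (coeFn_contL2 h0 hφ.continuous).symm)) (Prod.ext
    (Lp.ext (h2.trans (coeFn_contL2 h0 (continuous_frameDeriv hφ 1)).symm))
    (Lp.ext (h3.trans (coeFn_contL2 h0 (continuous_frameDeriv hφ Complex.I)).symm)))

/-- For fixed `u` the weak equation is a closed condition on the test pair, so smooth test functions
suffice. -/
theorem smooth_mem_laplacianGraph {δ : ℝ} (h0 : 0 < δ) {D : Set ℂ} {u : ℂ → ℝ}
    (hu : ContDiff ℝ ∞ u) (hD : ∀ z ∈ D, u z = 0) (hne : ∀ᵐ z ∂(annulusMeasure δ), u z ≠ 0)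
    {l : ℝ} (hgreen : ∀ v : ℂ → ℂ, ContDiff ℝ ∞ v → (∀ z ∈ D, v z = 0) →
      ∫ z, (starRingEnd ℂ (frameDeriv flatFactor 1 v z) *
          frameDeriv flatFactor 1 (fun z => (u z : ℂ)) z +
        starRingEnd ℂ (frameDeriv flatFactor Complex.I v z) *
          frameDeriv flatFactor Complex.I (fun z => (u z : ℂ)) z) ∂(annulusMeasure δ) =
      (l : ℂ) * ∫ z, starRingEnd ℂ (v z) * u z ∂(annulusMeasure δ)) :
    (contL2 h0 (fun z => (u z : ℂ)) (contDiff_ofReal hu).continuous,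
      (l : ℂ) • contL2 h0 (fun z => (u z : ℂ)) (contDiff_ofReal hu).continuous) ∈
      laplacianGraph (halfAnnulus δ) flatFactor D := by
  have hu' := contDiff_ofReal hu
  refine ⟨(smoothPair h0 _ hu').2, smoothPair_mem_gradGraph h0 hu hD hne, fun p hp => ?_⟩
  refine closure_minimal (t := {p | inner ℂ p.2.1 (smoothPair h0 _ hu').2.1 +
    inner ℂ p.2.2 (smoothPair h0 _ hu').2.2 = inner ℂ p.1 ((l : ℂ) • contL2 h0 _ hu'.continuous)})
    (fun p hp => ?_) (isClosed_eq (by fun_prop) (by fun_prop)) hp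
  obtain ⟨φ, hφ, hφD, rfl⟩ := exists_smoothPair_eq h0 hp
  simp only [mem_ofPred_eq, smoothPair, inner_smul_right, inner_contL2]
  rw [← hgreen φ hφ hφD, integral_add]
  · exact integrable_annulusMeasure h0 ((Complex.continuous_conj.comp
      (continuous_frameDeriv hφ _)).mul (continuous_frameDeriv hu' _))
  · exact integrable_annulusMeasure h0 ((Complex.continuous_conj.comp
      (continuous_frameDeriv hφ _)).mul (continuous_frameDeriv hu' _))

/-- The modes involve `log |z|` and `z/|z|`, singular at the origin, while the form domain asks for
functions smooth on all of `ℂ`. A cutoff inside `|z| < δ` does not affect the half-annulus. -/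
theorem exists_contDiff_eq {δ : ℝ} (h0 : 0 < δ) {g : ℂ → ℝ}
    (hg : ∀ z, z ≠ 0 → ContDiffAt ℝ ∞ g z) :
    ∃ u : ℂ → ℝ, ContDiff ℝ ∞ u ∧ ∀ z, δ ≤ ‖z‖ → u z = g z := by
  let b : ContDiffBump (0 : ℂ) := ⟨δ / 2, δ, by linarith, by linarith⟩
  refine ⟨fun z => (1 - b z) * g z, contDiff_iff_contDiffAt.2 fun z => ?_, fun z hz => ?_⟩
  · rcases eq_or_ne z 0 with rfl | hz
    · refine (contDiffAt_const (c := (0 : ℝ))).congr_of_eventuallyEq ?_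
      filter_upwards [b.eventuallyEq_one] with w hw
      simp [hw]
    · exact (contDiffAt_const.sub b.contDiffAt).mul (hg z hz)
  · have : b z = 0 := b.zero_of_le_dist (by simpa using hz)
    simp [this]

/-- The radial mode `sin (m a x)`, with `a = π / |log δ|`. -/
def radialMode (δ : ℝ) (m : ℤ) (x : ℝ) : ℝ := Real.sin (m * radialFreq δ * x)

/-- The derivative of the radial mode. -/
def radialModeDeriv (δ : ℝ) (m : ℤ) (x : ℝ) : ℝ :=
  m * radialFreq δ * Real.cos (m * radialFreq δ * x)

theorem isMode_radialMode (δ : ℝ) (m : ℤ) :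
    IsMode (radialMode δ m) (radialModeDeriv δ m) ((m * radialFreq δ) ^ 2) where
  hasDerivAt x := by
    have := ((hasDerivAt_id x).const_mul (m * radialFreq δ)).sin
    refine this.congr_deriv ?_
    simp only [radialModeDeriv, id]
    ring
  hasDerivAt_deriv x := by
    have := (((hasDerivAt_id x).const_mul (m * radialFreq δ)).cos).const_mul (m * radialFreq δ)
    refine this.congr_deriv ?_
    simp only [radialMode, id]
    ring

theorem radialMode_zero (δ : ℝ) (m : ℤ) : radialMode δ m 0 = 0 := by simp [radialMode]

theorem radialFreq_mul_log {δ : ℝ} (h0 : 0 < δ) (h1 : δ < 1) :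
    radialFreq δ * Real.log δ = -Real.pi := by
  have := (Real.log_neg h0 h1).ne
  rw [radialFreq]
  field_simp

theorem radialMode_log {δ : ℝ} (h0 : 0 < δ) (h1 : δ < 1) (m : ℤ) :
    radialMode δ m (Real.log δ) = 0 := by
  rw [radialMode, mul_assoc, radialFreq_mul_log h0 h1, mul_neg, Real.sin_neg, Real.sin_int_mul_pi,
    neg_zero]

theorem radialFreq_pos {δ : ℝ} (h0 : 0 < δ) (h1 : δ < 1) : 0 < radialFreq δ :=
  div_pos Real.pi_pos (neg_pos.2 (Real.log_neg h0 h1))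

theorem ae_radialMode_ne_zero {δ : ℝ} (h0 : 0 < δ) (h1 : δ < 1) {m : ℤ} (hm : m ≠ 0) :
    ∀ᵐ x, radialMode δ m x ≠ 0 := by
  have ha := (radialFreq_pos h0 h1).ne'
  have hm' : (m : ℝ) ≠ 0 := Int.cast_ne_zero.2 hm
  refine ae_ne_zero_of_analytic (x := Real.pi / 2 / (m * radialFreq δ)) ?_ ?_
  · intro x _
    exact Real.analyticAt_sin.comp (analyticAt_const.mul analyticAt_id)
  · rw [radialMode, mul_div_cancel₀ _ (mul_ne_zero hm' ha), Real.sin_pi_div_two]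
    exact one_ne_zero

/-- The angular eigenfunctions `h n`, of frequencies `n`, for a boundary condition on the
two segments such that functions vanish on `D`: `h n` with `n` in the range of `κ` span, the
function `h n` is the restriction of a function `A n` on the plane, and `ground * cos (k θ)` is a
combination of them. -/
structure AngularSystem (δ : ℝ) (D : Set ℂ) where
  /-- The eigenfunctions. -/
  h : ℤ → ℝ → ℝ
  /-- Their derivatives. -/
  h' : ℤ → ℝ → ℝ
  /-- The eigenfunctions as functions on the plane. -/
  A : ℕ → ℂ → ℝ
  /-- The enumeration of the frequencies. -/
  κ : ℕ → ℕ
  /-- The first eigenfunction. -/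
  ground : ℝ → ℝ
  isMode : ∀ n, IsMode (h n) (h' n) ((n : ℝ) ^ 2)
  ae_ne : ∀ n : ℕ, ∀ᵐ θ, h (κ n) θ ≠ 0
  κ_inj : Function.Injective κ
  wronskian : ∀ n m, h n 0 * h' m 0 = 0 ∧ h n Real.pi * h' m Real.pi = 0
  reduce : ∀ k : ℤ, ∃ (n : ℕ) (σ : ℝ), ∀ θ, h k θ = σ * h (κ n) θ
  ground_continuous : Continuous ground
  ground_ne : ∀ θ ∈ Ioo 0 Real.pi, ground θ ≠ 0
  ground_mul_cos : ∀ k : ℤ, ∃ (k₁ k₂ : ℤ) (r s : ℝ), ∀ θ,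
    ground θ * Real.cos (k * θ) = r * h k₁ θ + s * h k₂ θ
  contDiffAt_A : ∀ n z, z ≠ 0 → ContDiffAt ℝ ∞ (A n) z
  A_polarExp : ∀ n p, A n (polarExp p) = h n p.2
  le_norm : ∀ z ∈ D, δ ≤ ‖z‖
  halfCircles_subset : halfCircles δ ⊆ D
  A_eq_zero : ∀ n, ∀ z ∈ D, z ∈ halfCircles δ ∨ A n z = 0
  natural : ∀ (n : ℤ) (v : ℂ → ℂ), (∀ z ∈ D, v z = 0) → ∀ x ∈ Icc (Real.log δ) 0,
    v (polarExp (x, 0)) * h' n 0 = 0 ∧ v (polarExp (x, Real.pi)) * h' n Real.pi = 0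

namespace AngularSystem

variable {δ : ℝ} {D : Set ℂ} (S : AngularSystem δ D)

theorem polarExp_mem_halfCircles (h0 : 0 < δ) {θ : ℝ} (hθ : θ ∈ Icc 0 Real.pi) :
    polarExp (Real.log δ, θ) ∈ halfCircles δ ∧ polarExp (0, θ) ∈ halfCircles δ := by
  have hs := Real.sin_nonneg_of_mem_Icc hθ
  refine ⟨⟨Or.inl ?_, ?_⟩, ⟨Or.inr ?_, ?_⟩⟩
  · rw [norm_polarExp, Real.exp_log h0]
  · rw [im_polarExp]
    exact mul_nonneg (Real.exp_pos _).le hs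
  · rw [norm_polarExp, Real.exp_zero]
  · rw [im_polarExp]
    exact mul_nonneg (Real.exp_pos _).le hs

theorem exists_mode (h0 : 0 < δ) (h1 : δ < 1) (i : ℕ × ℕ) :
    ∃ u : ℂ → ℝ, ContDiff ℝ ∞ u ∧ (∀ z ∈ D, u z = 0) ∧
      ∀ p ∈ logRect δ, u (polarExp p) = radialMode δ (i.2 + 1 : ℕ) p.1 * S.h (S.κ i.1) p.2 := by
  obtain ⟨u, hu, hug⟩ := exists_contDiff_eq h0
    (g := fun z => radialMode δ (i.2 + 1 : ℕ) (Real.log ‖z‖) * S.A (S.κ i.1) z) fun z hz => by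
      refine ContDiffAt.mul ?_ (S.contDiffAt_A _ z hz)
      exact Real.contDiff_sin.contDiffAt.comp z (contDiffAt_const.mul
        ((contDiffAt_norm ℝ hz).log (norm_ne_zero_iff.2 hz)))
  refine ⟨u, hu, fun z hz => ?_, fun p hp => ?_⟩
  · rw [hug z (S.le_norm z hz)]
    rcases S.A_eq_zero (S.κ i.1) z hz with ⟨h | h, -⟩ | h
    · rw [h, radialMode_log h0 h1, zero_mul]
    · rw [h, Real.log_one, radialMode_zero, zero_mul]
    · rw [h, mul_zero]
  · have : δ ≤ ‖polarExp p‖ := by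
      rw [norm_polarExp]
      exact ((Real.log_lt_iff_lt_exp h0).1 hp.1.1).le
    rw [hug _ this, S.A_polarExp, norm_polarExp, Real.log_exp]

variable (h0 : 0 < δ) (h1 : δ < 1)

/-- The separated eigenfunctions on the half-annulus. -/
def mode (i : ℕ × ℕ) : ℂ → ℝ := (S.exists_mode h0 h1 i).choose

theorem contDiff_mode (i : ℕ × ℕ) : ContDiff ℝ ∞ (S.mode h0 h1 i) :=
  (S.exists_mode h0 h1 i).choose_spec.1

theorem mode_eq_zero (i : ℕ × ℕ) : ∀ z ∈ D, S.mode h0 h1 i z = 0 :=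
  (S.exists_mode h0 h1 i).choose_spec.2.1

theorem mode_polarExp (i : ℕ × ℕ) : ∀ p ∈ logRect δ, S.mode h0 h1 i (polarExp p) =
    radialMode δ (i.2 + 1 : ℕ) p.1 * S.h (S.κ i.1) p.2 :=
  (S.exists_mode h0 h1 i).choose_spec.2.2

theorem ae_mode_ne_zero (i : ℕ × ℕ) : ∀ᵐ z ∂(annulusMeasure δ), S.mode h0 h1 i z ≠ 0 := by
  rw [← (measurePreserving_polarExp h0).map_eq, ae_map_iff continuous_polarExp.aemeasurable
    (isOpen_ne_fun (S.contDiff_mode h0 h1 i).continuous continuous_const).measurableSet]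
  have hm : MeasurableSet (logRect δ) := measurableSet_Ioo.prod measurableSet_Ioo
  filter_upwards [ae_logRect_mul_ne_zero δ (ae_radialMode_ne_zero h0 h1
    (m := (i.2 + 1 : ℕ)) (by omega)) (S.ae_ne i.1), ae_restrict_mem hm] with p hp hp'
  rwa [S.mode_polarExp h0 h1 i p hp']

/-- The eigenvalues. -/
def eigenvalue (i : ℕ × ℕ) : ℝ := (S.κ i.1 : ℝ) ^ 2 + (radialFreq δ * (i.2 + 1)) ^ 2

/-- The separated eigenfunctions as elements of `L²`. -/
def modeL2 (i : ℕ × ℕ) : L2 (halfAnnulus δ) flatFactor :=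
  contL2 h0 (fun z => (S.mode h0 h1 i z : ℂ)) (contDiff_ofReal (S.contDiff_mode h0 h1 i)).continuous

theorem modeL2_mem_laplacianGraph (i : ℕ × ℕ) :
    (S.modeL2 h0 h1 i, (S.eigenvalue i : ℂ) • S.modeL2 h0 h1 i) ∈
      laplacianGraph (halfAnnulus δ) flatFactor D := by
  refine smooth_mem_laplacianGraph h0 (S.contDiff_mode h0 h1 i) (S.mode_eq_zero h0 h1 i)
    (S.ae_mode_ne_zero h0 h1 i) fun v hv hvD => ?_
  have h := green_separated h0 h1 (contDiff_ofReal (S.contDiff_mode h0 h1 i))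
    (isMode_radialMode δ (i.2 + 1 : ℕ)) (S.isMode (S.κ i.1)) (S.mode_polarExp h0 h1 i) hv
    (fun θ hθ => hvD _ (S.halfCircles_subset (polarExp_mem_halfCircles h0 hθ).1))
    (fun θ hθ => hvD _ (S.halfCircles_subset (polarExp_mem_halfCircles h0 hθ).2))
    (fun x hx => (S.natural _ v hvD x hx).1) (fun x hx => (S.natural _ v hvD x hx).2)
  rw [h]
  congr 2
  rw [eigenvalue]
  push_cast
  ring

/-- Different modes may share an eigenvalue, so symmetry of the operator is not enough. The integral
factors in logarithmic coordinates, and the factor whose index differs vanishes. -/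
theorem inner_modeL2 {i j : ℕ × ℕ} (hij : i ≠ j) :
    inner ℂ (S.modeL2 h0 h1 i) (S.modeL2 h0 h1 j) = 0 := by
  have hi := (contDiff_ofReal (S.contDiff_mode h0 h1 i)).continuous
  have hj := (contDiff_ofReal (S.contDiff_mode h0 h1 j)).continuous
  have hm : MeasurableSet (logRect δ) := measurableSet_Ioo.prod measurableSet_Ioo
  have hc : Continuous fun z => starRingEnd ℂ (S.mode h0 h1 i z : ℂ) * S.mode h0 h1 j z :=
    (Complex.continuous_conj.comp hi).mul hj
  rw [modeL2, modeL2, inner_contL2, integral_annulusMeasure h0 hc.aestronglyMeasurable]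
  set f := fun k : ℕ × ℕ => radialMode δ (k.2 + 1 : ℕ)
  set g := fun k : ℕ × ℕ => S.h (S.κ k.1)
  have hf : ∀ k, Continuous (f k) := fun k => (isMode_radialMode δ _).continuous
  have hg : ∀ k, Continuous (g k) := fun k => (S.isMode _).continuous
  have e : ∫ p in logRect δ, starRingEnd ℂ (S.mode h0 h1 i (polarExp p) : ℂ) *
      S.mode h0 h1 j (polarExp p) = ∫ p in logRect δ,
        (((f i p.1 * f j p.1 : ℝ) : ℂ) * ((g i p.2 * g j p.2 : ℝ) : ℂ)) :=
    setIntegral_congr_fun hm fun p hp => by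
      simp only [S.mode_polarExp h0 h1 _ p hp, Complex.conj_ofReal, f, g]
      push_cast
      ring
  rw [e, integral_logRect h0 h1 (by fun_prop)]
  simp only [intervalIntegral.integral_const_mul, intervalIntegral.integral_mul_const]
  rcases Classical.em (i.1 = j.1) with h | h
  · have hne : i.2 ≠ j.2 := fun h' => hij (Prod.ext h h')
    have hz : ∫ x in Real.log δ..0, ((f i x * f j x : ℝ) : ℂ) = 0 := by
      have := (isMode_radialMode δ (i.2 + 1 : ℕ)).integral_mul_eq_zero
        (isMode_radialMode δ (j.2 + 1 : ℕ)) (a := Real.log δ) (b := 0) (fun h' => hne ?_)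
        (by simp [radialMode_log h0 h1]) (by simp [radialMode_zero])
        (by simp [radialMode_log h0 h1]) (by simp [radialMode_zero])
      · simpa only [Complex.ofReal_mul] using this
      · have ha := radialFreq_pos h0 h1
        have h2 := (sq_eq_sq₀ (by positivity) (by positivity)).1 h'
        have h3 := mul_right_cancel₀ ha.ne' h2
        norm_cast at h3
        omega
    rw [hz, zero_mul]
  · have hz : ∫ x in 0..Real.pi, ((g i x * g j x : ℝ) : ℂ) = 0 := by
      have := (S.isMode (S.κ i.1)).integral_mul_eq_zero
        (S.isMode (S.κ j.1)) (a := 0) (b := Real.pi) (fun h' => h (S.κ_inj ?_))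
        (S.wronskian _ _).1 (S.wronskian _ _).2 (S.wronskian _ _).1 (S.wronskian _ _).2
      · simpa only [Complex.ofReal_mul] using this
      · have h2 := (sq_eq_sq₀ (by positivity) (by positivity)).1 h'
        exact_mod_cast h2
    rw [hz, mul_zero]

theorem modeL2_ne_zero (i : ℕ × ℕ) : S.modeL2 h0 h1 i ≠ 0 := by
  intro h
  have h2 : (fun z => (S.mode h0 h1 i z : ℂ)) =ᵐ[annulusMeasure δ] 0 :=
    (coeFn_contL2 h0 _).symm.trans ((Lp.eq_zero_iff_ae_eq_zero).1 h)
  have : NeBot (ae (annulusMeasure δ)) := ae_neBot.2 (annulusMeasure_ne_zero h0 h1)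
  obtain ⟨z, hz, hz'⟩ := (h2.and (S.ae_mode_ne_zero h0 h1 i)).exists
  exact hz' (by simpa using hz)

/-- Multiply `w` by the lowest mode `sin (a x) · ground θ`. By product-to-sum formulas the cosine
moments of the product are combinations of inner products of `w` with modes, so they vanish and the
product is zero; the lowest mode is nonzero almost everywhere. -/
theorem eq_zero_of_inner_modeL2 (w : L2 (halfAnnulus δ) flatFactor)
    (hw : ∀ i, inner ℂ (S.modeL2 h0 h1 i) w = 0) : w = 0 := by
  have := isFiniteMeasure_annulusMeasure h0
  have hm : MeasurableSet (logRect δ) := measurableSet_Ioo.prod measurableSet_Ioo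
  have hmp := measurePreserving_polarExp h0
  have hwi : IntegrableOn (fun p => w (polarExp p)) (logRect δ) := by
    have : Integrable w (annulusMeasure δ) := (Lp.memLp w).integrable (by norm_num)
    exact hmp.integrable_comp_of_integrable this
  have hbase : ∀ i : ℕ × ℕ, ∫ p in logRect δ,
      w (polarExp p) * ((radialMode δ (i.2 + 1 : ℕ) p.1 * S.h (S.κ i.1) p.2 : ℝ) : ℂ) = 0 := by
    intro i
    have hi := (contDiff_ofReal (S.contDiff_mode h0 h1 i)).continuous
    rw [← hw i, L2.inner_def]
    have e : ∫ z, inner ℂ (S.modeL2 h0 h1 i z) (w z) ∂(annulusMeasure δ) =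
        ∫ z, w z * (S.mode h0 h1 i z : ℂ) ∂(annulusMeasure δ) := by
      refine integral_congr_ae ?_
      filter_upwards [coeFn_contL2 h0 hi] with z hz
      rw [modeL2, hz, RCLike.inner_apply, Complex.conj_ofReal]
    rw [e, integral_annulusMeasure (f := fun z => w z * (S.mode h0 h1 i z : ℂ)) h0
      ((Lp.aestronglyMeasurable w).mul hi.aestronglyMeasurable)]
    refine setIntegral_congr_fun hm fun p hp => ?_
    simp only [S.mode_polarExp h0 h1 i p hp]
  have hcont : ∀ m n : ℤ, Continuous fun p : ℝ × ℝ => radialMode δ m p.1 * S.h n p.2 := fun m n =>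
    ((isMode_radialMode δ m).continuous.comp continuous_fst).mul
      ((S.isMode n).continuous.comp continuous_snd)
  have hall : ∀ m n : ℤ, ∫ p in logRect δ,
      w (polarExp p) * ((radialMode δ m p.1 * S.h n p.2 : ℝ) : ℂ) = 0 := by
    intro m n
    obtain ⟨n', σ, hσ⟩ := S.reduce n
    -- The product formulas yield all integer frequencies; parity of the sine brings them back to
    -- positive ones, and frequency `0` gives the zero function.
    have hm : ∃ (m' : ℕ) (τ : ℝ), ∀ x, radialMode δ m x = τ * radialMode δ (m' + 1 : ℕ) x := by
      rcases lt_trichotomy m 0 with h | h | h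
      · refine ⟨(-m - 1).toNat, -1, fun x => ?_⟩
        have : (((-m - 1).toNat + 1 : ℕ) : ℤ) = -m := by omega
        rw [this, radialMode, radialMode, Int.cast_neg, neg_mul (m : ℝ), neg_mul (_ * _),
          Real.sin_neg]
        ring
      · exact ⟨0, 0, fun x => by simp [h, radialMode]⟩
      · refine ⟨(m - 1).toNat, 1, fun x => ?_⟩
        have : (((m - 1).toNat + 1 : ℕ) : ℤ) = m := by omega
        rw [this, one_mul]
    obtain ⟨m', τ, hτ⟩ := hm
    have := hbase (n', m')
    calc _ = ∫ p in logRect δ, ((τ * σ : ℝ) : ℂ) * (w (polarExp p) *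
          ((radialMode δ (m' + 1 : ℕ) p.1 * S.h (S.κ n') p.2 : ℝ) : ℂ)) := by
          refine setIntegral_congr_fun ‹_› fun p _ => ?_
          simp only [hτ, hσ]
          push_cast
          ring
      _ = 0 := by rw [integral_const_mul, this, mul_zero]
  have hmul : ∀ g : ℝ × ℝ → ℝ, Continuous g →
      IntegrableOn (fun p => w (polarExp p) * (g p : ℂ)) (logRect δ) := fun g hg => by
    obtain ⟨C, hC⟩ := (isCompact_Icc.prod isCompact_Icc :
      IsCompact (closedRect δ)).exists_bound_of_continuousOn hg.continuousOn
    refine hwi.mul_bdd (c := C)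
      (Complex.continuous_ofReal.comp hg).aestronglyMeasurable ?_
    filter_upwards [ae_restrict_mem hm] with p hp
    refine (Complex.norm_real _).trans_le (hC p ⟨Ioo_subset_Icc_self hp.1, Ioo_subset_Icc_self hp.2⟩)
  set F : ℝ × ℝ → ℂ := fun p => w (polarExp p) * ((radialMode δ 1 p.1 * S.ground p.2 : ℝ) : ℂ)
  have hF : IntegrableOn F (logRect δ) := hmul _
    (((isMode_radialMode δ 1).continuous.comp continuous_fst).mul
      (S.ground_continuous.comp continuous_snd))
  have hzero := ae_eq_zero_of_cos_moments h0 h1 hF fun j k => by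
    obtain ⟨k₁, k₂, r, s, hrs⟩ := S.ground_mul_cos k
    have htrig : ∀ x, radialMode δ 1 x * Real.cos (j * (radialFreq δ * x)) =
        1 / 2 * radialMode δ (j + 1) x - 1 / 2 * radialMode δ (j - 1) x := fun x => by
      simp only [radialMode]
      push_cast
      rw [one_mul, add_mul, add_mul, sub_mul, sub_mul, one_mul, Real.sin_add, Real.sin_sub,
        mul_assoc (j : ℝ)]
      ring
    have hi := fun m n => hmul _ (hcont m n)
    have e : ∀ p : ℝ × ℝ, F p * ((Real.cos (j * (radialFreq δ * p.1)) * Real.cos (k * p.2) : ℝ) : ℂ)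
        = ((1 / 2 * r : ℝ) : ℂ) * (w (polarExp p) *
            ((radialMode δ (j + 1) p.1 * S.h k₁ p.2 : ℝ) : ℂ)) +
          ((1 / 2 * s : ℝ) : ℂ) * (w (polarExp p) *
            ((radialMode δ (j + 1) p.1 * S.h k₂ p.2 : ℝ) : ℂ)) +
          (((-(1 / 2) * r : ℝ) : ℂ) * (w (polarExp p) *
            ((radialMode δ (j - 1) p.1 * S.h k₁ p.2 : ℝ) : ℂ)) +
          ((-(1 / 2) * s : ℝ) : ℂ) * (w (polarExp p) *
            ((radialMode δ (j - 1) p.1 * S.h k₂ p.2 : ℝ) : ℂ))) := fun p => by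
      have h3 : (radialMode δ 1 p.1 * S.ground p.2) *
          (Real.cos (j * (radialFreq δ * p.1)) * Real.cos (k * p.2)) =
          (1 / 2 * radialMode δ (j + 1) p.1 - 1 / 2 * radialMode δ (j - 1) p.1) *
          (r * S.h k₁ p.2 + s * S.h k₂ p.2) := by
        rw [← htrig, ← hrs]; ring
      simp only [F]
      rw [mul_assoc, ← Complex.ofReal_mul, h3]
      push_cast
      ring
    simp only [e]
    rw [integral_add, integral_add, integral_add]
    · simp only [integral_const_mul, hall, mul_zero, add_zero]
    all_goals first
      | exact (hi _ _).const_mul _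
      | exact ((hi _ _).const_mul _).add ((hi _ _).const_mul _)
  have hw0 : ∀ᵐ p ∂(volume.restrict (logRect δ)), w (polarExp p) = 0 := by
    filter_upwards [hzero, ae_restrict_of_ae (s := logRect δ)
      (Measure.quasiMeasurePreserving_fst.ae (ae_radialMode_ne_zero h0 h1 one_ne_zero)),
      ae_restrict_mem hm] with p hp hr hpm
    refine (mul_eq_zero.1 hp).resolve_right ?_
    exact Complex.ofReal_ne_zero.2 (mul_ne_zero hr (S.ground_ne _ hpm.2))
  refine (Lp.eq_zero_iff_ae_eq_zero).2 ?_
  have hws := (Lp.stronglyMeasurable w)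
  have : ∀ᵐ z ∂(annulusMeasure δ), w z = 0 := by
    rw [← hmp.map_eq, ae_map_iff continuous_polarExp.aemeasurable
      (measurableSet_eq_fun hws.measurable measurable_const)]
    exact hw0
  exact this

/-- The orthonormal eigenbasis. -/
theorem exists_eigenbasis (h0 : 0 < δ) (h1 : δ < 1) :
    ∃ b : HilbertBasis (ℕ × ℕ) ℂ (L2 (halfAnnulus δ) flatFactor),
    ∀ i, ((b i : L2 (halfAnnulus δ) flatFactor), (S.eigenvalue i : ℂ) • b i) ∈
      laplacianGraph (halfAnnulus δ) flatFactor D := by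
  set e : ℕ × ℕ → L2 (halfAnnulus δ) flatFactor := fun i =>
    ((‖S.modeL2 h0 h1 i‖⁻¹ : ℝ) : ℂ) • S.modeL2 h0 h1 i with he
  have hon : Orthonormal ℂ e := by
    refine ⟨fun i => ?_, fun i j hij => ?_⟩
    · rw [he, norm_smul, Complex.norm_real, norm_inv, norm_norm,
        inv_mul_cancel₀ (norm_ne_zero_iff.2 (S.modeL2_ne_zero h0 h1 i))]
    · change inner ℂ (e i) (e j) = 0
      rw [he, inner_smul_left, inner_smul_right, S.inner_modeL2 h0 h1 hij, mul_zero, mul_zero]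
  have hbot : (Submodule.span ℂ (range e))ᗮ = ⊥ := by
    rw [Submodule.eq_bot_iff]
    intro w hw
    refine S.eq_zero_of_inner_modeL2 h0 h1 w fun i => ?_
    have h := (Submodule.mem_orthogonal _ _).1 hw (e i) (Submodule.subset_span ⟨i, rfl⟩)
    rw [he, inner_smul_left] at h
    refine (mul_eq_zero.1 h).resolve_left ?_
    rw [Complex.conj_ofReal]
    exact Complex.ofReal_ne_zero.2 (inv_ne_zero (norm_ne_zero_iff.2 (S.modeL2_ne_zero h0 h1 i)))
  refine ⟨HilbertBasis.mkOfOrthogonalEqBot hon hbot, fun i => ?_⟩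
  rw [HilbertBasis.coe_mkOfOrthogonalEqBot]
  have := Submodule.smul_mem _ (((‖S.modeL2 h0 h1 i‖⁻¹ : ℝ) : ℂ))
    (S.modeL2_mem_laplacianGraph h0 h1 i)
  rwa [Prod.smul_mk, smul_comm] at this

end AngularSystem

end Eigenbasis

end SpectralDet

namespace SpectralDet

/-! ### The two boundary conditions -/

noncomputable section BoundaryConditions

theorem isMode_cos (n : ℝ) : IsMode (fun θ => Real.cos (n * θ)) (fun θ => -n * Real.sin (n * θ))
    (n ^ 2) where
  hasDerivAt x := by
    refine ((hasDerivAt_id x).const_mul n).cos.congr_deriv ?_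
    simp only [id]
    ring
  hasDerivAt_deriv x := by
    refine (((hasDerivAt_id x).const_mul n).sin.const_mul (-n)).congr_deriv ?_
    simp only [id]
    ring

theorem isMode_sin (n : ℝ) : IsMode (fun θ => Real.sin (n * θ)) (fun θ => n * Real.cos (n * θ))
    (n ^ 2) where
  hasDerivAt x := by
    refine ((hasDerivAt_id x).const_mul n).sin.congr_deriv ?_
    simp only [id]
    ring
  hasDerivAt_deriv x := by
    refine (((hasDerivAt_id x).const_mul n).cos.const_mul n).congr_deriv ?_
    simp only [id]
    ring

theorem ae_cos_mul_ne_zero (n : ℝ) : ∀ᵐ θ : ℝ, Real.cos (n * θ) ≠ 0 := by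
  refine ae_ne_zero_of_analytic (f := fun θ => Real.cos (n * θ)) (x := 0) (fun x _ => ?_) (by simp)
  exact Real.analyticAt_cos.comp (analyticAt_const.mul analyticAt_id)

theorem ae_sin_mul_ne_zero {n : ℝ} (hn : n ≠ 0) : ∀ᵐ θ : ℝ, Real.sin (n * θ) ≠ 0 := by
  refine ae_ne_zero_of_analytic (f := fun θ => Real.sin (n * θ)) (x := Real.pi / 2 / n)
    (fun x _ => ?_) ?_
  · exact Real.analyticAt_sin.comp (analyticAt_const.mul analyticAt_id)
  · rw [mul_div_cancel₀ _ hn, Real.sin_pi_div_two]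
    exact one_ne_zero

/-- The function `(z / |z|) ^ n`. -/
def phasePow (n : ℕ) (z : ℂ) : ℂ := (((‖z‖⁻¹ : ℝ) : ℂ) * z) ^ n

theorem contDiffAt_phasePow (n : ℕ) {z : ℂ} (hz : z ≠ 0) : ContDiffAt ℝ ∞ (phasePow n) z := by
  have h : ContDiffAt ℝ ∞ (fun z : ℂ => ((‖z‖⁻¹ : ℝ) : ℂ)) z :=
    Complex.ofRealCLM.contDiff.contDiffAt.comp z
      ((contDiffAt_norm ℝ hz).inv (norm_ne_zero_iff.2 hz))
  exact (h.mul contDiffAt_id).pow n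

theorem phasePow_polarExp (n : ℕ) (p : ℝ × ℝ) :
    phasePow n (polarExp p) = Complex.exp ((n * p.2 : ℝ) * Complex.I) := by
  have h : (((‖polarExp p‖⁻¹ : ℝ) : ℂ) * polarExp p) = Complex.exp (p.2 * Complex.I) := by
    rw [norm_polarExp, ← Real.exp_neg, Complex.ofReal_exp, polarExp, ← Complex.exp_add]
    congr 1
    push_cast
    ring
  rw [phasePow, h, ← Complex.exp_nat_mul]
  congr 1
  push_cast
  ring

/-- The angular system of the mixed problem: Neumann conditions on the two segments. -/
def mixedSystem {δ : ℝ} (h1 : δ < 1) : AngularSystem δ (halfCircles δ) where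
  h n θ := Real.cos (n * θ)
  h' n θ := -n * Real.sin (n * θ)
  A n z := (phasePow n z).re
  κ n := n
  ground _ := 1
  isMode n := isMode_cos n
  ae_ne n := ae_cos_mul_ne_zero _
  κ_inj := fun _ _ h => h
  wronskian n m := by simp [Real.sin_int_mul_pi]
  reduce k := ⟨k.natAbs, 1, fun θ => by
    rcases Int.natAbs_eq k with h | h
    · rw [← h, one_mul]
    · have : ((k.natAbs : ℤ) : ℝ) = -k := by
        rw [← Int.cast_neg]
        congr 1
        omega
      rw [this, neg_mul, Real.cos_neg, one_mul]⟩
  ground_continuous := continuous_const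
  ground_ne _ _ := one_ne_zero
  ground_mul_cos k := ⟨k, k, 1, 0, fun θ => by ring⟩
  contDiffAt_A n z hz := Complex.reCLM.contDiff.contDiffAt.comp z (contDiffAt_phasePow n hz)
  A_polarExp n p := by
    rw [phasePow_polarExp, Complex.exp_ofReal_mul_I_re]
    rfl
  le_norm z hz := by
    rcases hz with ⟨h | h, -⟩ <;> linarith
  halfCircles_subset := subset_rfl
  A_eq_zero n z hz := Or.inl hz
  natural n v _ x _ := by simp [Real.sin_int_mul_pi]

theorem mem_closure_halfAnnulus {δ : ℝ} (h0 : 0 < δ) (h1 : δ < 1) {z : ℂ} :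
    z ∈ closure (halfAnnulus δ) ↔ δ ≤ ‖z‖ ∧ ‖z‖ ≤ 1 ∧ 0 ≤ z.im := by
  constructor
  · have hcl : IsClosed {z : ℂ | δ ≤ ‖z‖ ∧ ‖z‖ ≤ 1 ∧ 0 ≤ z.im} :=
      (isClosed_le continuous_const continuous_norm).inter
        ((isClosed_le continuous_norm continuous_const).inter
          (isClosed_le continuous_const Complex.continuous_im))
    have hsub : halfAnnulus δ ⊆ {z : ℂ | δ ≤ ‖z‖ ∧ ‖z‖ ≤ 1 ∧ 0 ≤ z.im} :=
      fun w hw => ⟨hw.1.le, hw.2.1.le, hw.2.2.le⟩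
    exact fun h => closure_minimal hsub hcl h
  · rintro ⟨hz1, hz2, hz3⟩
    have hz : z ≠ 0 := fun h => by simp [h] at hz1; linarith
    have hlog := Real.log_neg h0 h1
    -- Each such `z` is the image under `polarExp` of a point of the closed rectangle, and a
    -- continuous map sends the closure of the open rectangle into the closure of its image.
    have hmem : (Real.log ‖z‖, z.arg) ∈ closure (logRect δ) := by
      rw [logRect, closure_prod_eq, closure_Ioo hlog.ne, closure_Ioo Real.pi_pos.ne]
      exact ⟨⟨Real.log_le_log h0 hz1, Real.log_nonpos (norm_nonneg _) hz2⟩,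
        Complex.arg_nonneg_iff.2 hz3, Complex.arg_le_pi z⟩
    have he : polarExp (Real.log ‖z‖, z.arg) = z := by
      have := Complex.exp_log hz
      rwa [Complex.log] at this
    rw [← he]
    refine map_mem_closure continuous_polarExp hmem fun p hp => ?_
    refine ⟨?_, ?_, ?_⟩
    · rw [norm_polarExp]
      exact (Real.log_lt_iff_lt_exp h0).1 hp.1.1
    · rw [norm_polarExp]
      exact Real.exp_lt_one_iff.2 hp.1.2
    · rw [im_polarExp]
      exact mul_pos (Real.exp_pos _) (Real.sin_pos_of_pos_of_lt_pi hp.2.1 hp.2.2)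

theorem mem_frontier_halfAnnulus {δ : ℝ} (h0 : 0 < δ) (h1 : δ < 1) {z : ℂ} :
    z ∈ frontier (halfAnnulus δ) ↔ (δ ≤ ‖z‖ ∧ ‖z‖ ≤ 1 ∧ 0 ≤ z.im) ∧ z ∉ halfAnnulus δ := by
  rw [(isOpen_halfAnnulus δ).frontier_eq, Set.mem_sdiff, mem_closure_halfAnnulus h0 h1]

theorem polarExp_mem_frontier {δ : ℝ} (h0 : 0 < δ) (h1 : δ < 1) {x θ : ℝ}
    (hx : x ∈ Icc (Real.log δ) 0) (hθ : Real.sin θ = 0) :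
    polarExp (x, θ) ∈ frontier (halfAnnulus δ) := by
  have him : (polarExp (x, θ)).im = 0 := by rw [im_polarExp]; simp [hθ]
  rw [mem_frontier_halfAnnulus h0 h1, norm_polarExp]
  refine ⟨⟨?_, Real.exp_le_one_iff.2 hx.2, him.ge⟩, fun h => h.2.2.ne' him⟩
  rw [← Real.exp_log h0]
  exact Real.exp_le_exp.2 hx.1

/-- The angular system of the Dirichlet problem. -/
def dirichletSystem {δ : ℝ} (h0 : 0 < δ) (h1 : δ < 1) :
    AngularSystem δ (frontier (halfAnnulus δ)) where
  h n θ := Real.sin (n * θ)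
  h' n θ := n * Real.cos (n * θ)
  A n z := (phasePow n z).im
  -- Frequencies start at `1`, since `sin (0 θ)` vanishes identically; in the Neumann case the
  -- constant mode counts.
  κ n := n + 1
  ground := Real.sin
  isMode n := isMode_sin n
  ae_ne n := ae_sin_mul_ne_zero (by push_cast; positivity)
  κ_inj := fun _ _ h => by simpa using h
  wronskian n m := by simp [Real.sin_int_mul_pi]
  reduce k := by
    rcases lt_trichotomy k 0 with h | h | h
    · refine ⟨(-k - 1).toNat, -1, fun x => ?_⟩
      have : (((-k - 1).toNat + 1 : ℕ) : ℤ) = -k := by omega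
      rw [this, Int.cast_neg, neg_mul (k : ℝ), Real.sin_neg]
      ring
    · exact ⟨0, 0, fun x => by simp [h]⟩
    · refine ⟨(k - 1).toNat, 1, fun x => ?_⟩
      have : (((k - 1).toNat + 1 : ℕ) : ℤ) = k := by omega
      rw [this, one_mul]
  ground_continuous := Real.continuous_sin
  ground_ne θ hθ := (Real.sin_pos_of_pos_of_lt_pi hθ.1 hθ.2).ne'
  ground_mul_cos k := ⟨k + 1, k - 1, 1 / 2, -(1 / 2), fun θ => by
    push_cast
    rw [add_mul, sub_mul, one_mul, Real.sin_add, Real.sin_sub]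
    ring⟩
  contDiffAt_A n z hz := Complex.imCLM.contDiff.contDiffAt.comp z (contDiffAt_phasePow n hz)
  A_polarExp n p := by
    rw [phasePow_polarExp, Complex.exp_ofReal_mul_I_im]
    rfl
  le_norm z hz := ((mem_frontier_halfAnnulus h0 h1).1 hz).1.1
  halfCircles_subset z hz := by
    rw [mem_frontier_halfAnnulus h0 h1]
    rcases hz with ⟨h | h, h'⟩
    · exact ⟨⟨h.ge, by linarith, h'⟩, fun hz => hz.1.ne' h⟩
    · exact ⟨⟨by linarith, h.le, h'⟩, fun hz => hz.2.1.ne h⟩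
  A_eq_zero n z hz := by
    obtain ⟨⟨h2, h3, h4⟩, h5⟩ := (mem_frontier_halfAnnulus h0 h1).1 hz
    rcases h2.eq_or_lt with h | h2
    · exact Or.inl ⟨Or.inl h.symm, h4⟩
    rcases h3.eq_or_lt with h | h3
    · exact Or.inl ⟨Or.inr h, h4⟩
    refine Or.inr ?_
    have him : z.im = 0 := le_antisymm (not_lt.1 fun h => h5 ⟨h2, h3, h⟩) h4
    have hz' : z = (z.re : ℂ) := Complex.ext rfl (by simpa using him)
    rw [phasePow, hz', ← Complex.ofReal_mul, ← Complex.ofReal_pow, Complex.ofReal_im]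
  natural n v hv x hx := by
    rw [hv _ (polarExp_mem_frontier h0 h1 hx Real.sin_zero),
      hv _ (polarExp_mem_frontier h0 h1 hx Real.sin_pi), zero_mul, zero_mul]
    exact ⟨rfl, rfl⟩

theorem AngularSystem.eigenvalue_pos {δ : ℝ} {D : Set ℂ} (S : AngularSystem δ D) (h0 : 0 < δ)
    (h1 : δ < 1) (i : ℕ × ℕ) : 0 < S.eigenvalue i := by
  have := radialFreq_pos h0 h1
  unfold AngularSystem.eigenvalue
  positivity

theorem AngularSystem.isSpectralZeta {δ : ℝ} {D : Set ℂ} (S : AngularSystem δ D) (h0 : 0 < δ)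
    (h1 : δ < 1) (hg : (laplacian (halfAnnulus δ) flatFactor D).graph =
      laplacianGraph (halfAnnulus δ) flatFactor D) {Z : ℂ → ℂ}
    (hZ : ∀ s : ℂ, 2 < s.re → HasSum (fun i => (S.eigenvalue i : ℂ) ^ (-s)) (Z s))
    (hm : Meromorphic Z) (ha : AnalyticAt ℂ Z 0) :
    IsSpectralZeta (laplacian (halfAnnulus δ) flatFactor D) Z := by
  obtain ⟨b, hb⟩ := S.exists_eigenbasis h0 h1
  have hpos := S.eigenvalue_pos h0 h1
  refine ⟨isSelfAdjoint_of_hilbertBasis _ b S.eigenvalue ?_ ?_ ?_,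
    ⟨ℕ × ℕ, b, S.eigenvalue, fun i => ⟨(hpos i).le, ?_⟩, 2, fun s hs => ?_⟩, hm, ha⟩
  · rwa [hg]
  · rw [hg]
    exact fun p hp q hq => laplacianGraph_symm hp hq
  · rw [hg]
    exact isClosed_laplacianGraph
  · rw [hg]
    exact hb i
  -- Every eigenvalue is positive because `m ≥ 1`, so discarding zero eigenvalues discards nothing.
  · have := (Equiv.subtypeUnivEquiv fun i => (hpos i).ne').hasSum_iff
      (f := fun i => (S.eigenvalue i : ℂ) ^ (-s)) (a := Z s)
    exact this.2 (hZ s hs)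

end BoundaryConditions

end SpectralDet

/-! ### The determinants of the half-annulus, from the rectangle of side `L = -log δ` -/

theorem mainTheorem9 (δ : ℝ) (hδ0 : 0 < δ) (hδ1 : δ < 1) :
    Multipliable (fun n : ℕ => 1 - δ ^ (2 * (n + 1))) ∧
    SpectralDet.HasZetaDet (SpectralDet.mixedLaplacian δ)
      (-√(2 / Real.pi) * Real.log δ * δ ^ (1 / 12 : ℝ) * ∏' n : ℕ, (1 - δ ^ (2 * (n + 1)))) ∧
    SpectralDet.HasZetaDet (SpectralDet.dirichletLaplacian δ)
      (1 / √(2 * Real.pi) * δ ^ (1 / 12 : ℝ) * ∏' n : ℕ, (1 - δ ^ (2 * (n + 1)))) := by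
  have hL : 0 < -Real.log δ := neg_pos.2 (Real.log_neg hδ0 hδ1)
  refine ⟨(SpectralDet.exp_neg_deriv_rectangleZeta hδ0 hδ1).1,
    ⟨SpectralDet.mixedRectangleZeta (-Real.log δ), ?_,
      SpectralDet.exp_neg_deriv_mixedRectangleZeta hδ0 hδ1⟩,
    ⟨SpectralDet.rectangleZeta (-Real.log δ), ?_,
      (SpectralDet.exp_neg_deriv_rectangleZeta hδ0 hδ1).2⟩⟩
  · exact (SpectralDet.mixedSystem hδ1).isSpectralZeta hδ0 hδ1
      (SpectralDet.mixedLaplacian_graph δ)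
      (fun s hs => SpectralDet.hasSum_mixedRectangleZeta hL hs)
      (SpectralDet.meromorphic_mixedRectangleZeta hL)
      (SpectralDet.analyticAt_mixedRectangleZeta_zero hL)
  · refine (SpectralDet.dirichletSystem hδ0 hδ1).isSpectralZeta hδ0 hδ1
      (SpectralDet.dirichletLaplacian_graph δ) (fun s hs => ?_)
      (SpectralDet.meromorphic_rectangleZeta hL)
      (SpectralDet.analyticAt_rectangleZeta_zero hL)
    have h := SpectralDet.hasSum_rectangleZeta hL hs
    refine h.congr_fun fun i => ?_
    simp [SpectralDet.AngularSystem.eigenvalue, SpectralDet.dirichletSystem,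
      SpectralDet.radialFreq]
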